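/- All graphs are finite, undirected, without loops or multiple edges. Let $M\in\mathbb F_2^{V(K_{3,3})\times E(K_{3,3})}$ be the vertex–edge incidence matrix of $K_{3,3}$, and for $k\in V(K_{3,3})$ let $S_k$ be the set of the three edges $i$ with $M_{ki}=1$. For $b\in\mathbb F_2^{V(K_{3,3})}$ let $G_*(M,b)$ be the following vertex- and edge-colored graph. Its vertices are the pairs $(k,\alpha)$ with $k\in V(K_{3,3})$ and $\alpha:S_k\to\{\pm1\}$ satisfying $\prod_{i\in S_k}\alpha_i=(-1)^{b_k}$; the color of $(k,\alpha)$ is $k$. Any two distinct vertices $(k,\alpha),(k,\beta)$ are joined by an edge whose color is the function $\alpha\triangle\beta:S_k\to\{\pm1\}$, $i\mapsto\alpha_i\beta_i$. For $k\neq l$, the vertices $(k,\alpha)$ and $(l,\beta)$ are joined by an edge, of color $-1$, if and only if $S_k\cap S_l$ consists of a single edge $i$ and $\alpha_i\beta_i=-1$. Fix non-negative integers $n_k$, one for each vertex color $k$ and pairwise distinct, and non-negative integers $m_c$, one for each edge color $c\neq-1$ and pairwise distinct. Let $G_*''(M,b)$ be the uncolored graph obtained from $G_*(M,b)$ by attaching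 a path of length $n_k$ (that is, with $n_k$ new vertices) at every vertex of color $k$, subdividing every edge of color $c\neq-1$ by one new vertex, attaching a path of length $m_c$ at that new vertex, and then forgetting all colors. For a graph $G$ with adjacency matrix $A_G$, let $C(\mathrm{Qut}(G))$ be the universal unital $C^*$-algebra generated by elements $u_{ij}$, $i,j\in V(G)$, with $u_{ij}=u_{ij}^*=u_{ij}^2$, $\sum_l u_{il}=1=\sum_l u_{li}$ and $A_Gu=uA_G$. The graph $G$ has no quantum symmetry if $C(\mathrm{Qut}(G))$ is commutative. In the $(G,G')$-isomorphism game the inputs and outputs of Alice and Bob lie in the disjoint union $V(G)\sqcup V(G')$; each player must answer an input from one graph with a vertex of the other graph, and, if $g_a,g_b\in V(G)$ and $g_a',g_b'\in V(G')$ are the vertices so obtained from Alice's and Bob's input and output, they win if and only if ($g_a=g_b\Leftrightarrow g_a'=g_b'$) and ($g_ag_b\in E(G)\Leftrightarrow g_a'g_b'\in E(G')$). The graphs $G$ and $G'$ are quantum isomorphic if some commuting operator quantum strategy wins this game with probability $1$. Corollary 6.9. Let $b\in\mathbb F_2^{V(K_{3,3})}$ have exactly one entry equal to $1$, and construct $G_*''(M,0)$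 and $G_*''(M,b)$ with the same lengths $n_k$ and $m_c$. Then $G_*''(M,0)$ and $G_*''(M,b)$ are not isomorphic, neither of them has quantum symmetry, and they are quantum isomorphic. -/

import Mathlib

open scoped ENNReal

noncomputable section

/-! ### Quantum automorphism group of a graph -/

/-- `u` is a magic unitary over the unital C⋆-algebra `A` that commutes with the adjacency matrix
of `G`: these are the defining relations of the quantum automorphism group of `G`. -/
structure IsQuantumAutomorphism {V : Type*} [Fintype V] (G : SimpleGraph V)
    {A : Type*} [CStarAlgebra A] (u : Matrix V V A) : Prop where
  isStarProjection : ∀ i j, IsStarProjection (u i j)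
  row_sum : ∀ i, ∑ l, u i l = 1
  col_sum : ∀ j, ∑ l, u l j = 1
  adj_comm : open Classical in G.adjMatrix A * u = u * G.adjMatrix A

/-- A representation of the generators and relations of `C(Qut(G))` in a nontrivial unital
C⋆-algebra. -/
structure QutRep {V : Type*} [Fintype V] (G : SimpleGraph V) where
  A : Type
  [cstar : CStarAlgebra A]
  [nontriv : Nontrivial A]
  u : Matrix V V A
  isQuantumAutomorphism : IsQuantumAutomorphism G u

attribute [instance] QutRep.cstar QutRep.nontriv

/-- The C⋆-algebra of bounded families indexed by all representations of the relations. -/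
abbrev QutProduct {V : Type*} [Fintype V] (G : SimpleGraph V) : Type _ :=
  lp (fun π : QutRep G => π.A) ∞

instance {V : Type*} [Fintype V] (G : SimpleGraph V) : CStarAlgebra (QutProduct G) where

theorem IsStarProjection.norm_le_one_of_cstar {A : Type*} [CStarAlgebra A] {p : A}
    (hp : IsStarProjection p) : ‖p‖ ≤ 1 := by
  have h := CStarRing.norm_star_mul_self (x := p)
  rw [hp.isSelfAdjoint.star_eq, hp.isIdempotentElem.eq] at h
  by_contra! hlt
  nlinarith

/-- The generator `u i j`, as a bounded family. -/
def qutGen {V : Type*} [Fintype V] (G : SimpleGraph V) (i j : V) : QutProduct G :=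
  ⟨fun π => π.u i j, memℓp_infty ⟨1, by
    rintro _ ⟨π, rfl⟩
    exact (π.isQuantumAutomorphism.isStarProjection i j).norm_le_one_of_cstar⟩⟩

/-- The C⋆-algebra `C(Qut(G))`: the universal unital C⋆-algebra generated by the entries of a magic
unitary commuting with the adjacency matrix of `G`, realised as the closed ⋆-subalgebra generated
by the `qutGen G i j`, so that the norm is the supremum over all representations. Its universal
property is `CQut.existsUnique_hom` below. -/
def CQut {V : Type*} [Fintype V] (G : SimpleGraph V) : StarSubalgebra ℂ (QutProduct G) :=
  (StarAlgebra.adjoin ℂ (Set.range fun p : V × V => qutGen G p.1 p.2)).topologicalClosure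

instance {V : Type*} [Fintype V] (G : SimpleGraph V) : CStarAlgebra (CQut G) :=
  StarSubalgebra.cstarAlgebra _ (h_closed := StarSubalgebra.isClosed_topologicalClosure _)

/-- The fundamental representation of `Qut(G)`. -/
def CQut.u {V : Type*} [Fintype V] (G : SimpleGraph V) : Matrix V V (CQut G) :=
  fun i j => ⟨qutGen G i j, StarSubalgebra.le_topologicalClosure _
    (StarAlgebra.subset_adjoin ℂ _ ⟨(i, j), rfl⟩)⟩

/-- Evaluation at a representation. -/
def CQut.eval {V : Type*} [Fintype V] {G : SimpleGraph V} (π : QutRep G) : CQut G →⋆ₐ[ℂ] π.A where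
  toFun x := x.1.1 π
  map_one' := rfl
  map_mul' _ _ := rfl
  map_zero' := rfl
  map_add' _ _ := rfl
  commutes' _ := rfl
  map_star' _ := rfl

theorem CQut.ext_eval {V : Type*} [Fintype V] {G : SimpleGraph V} {x y : CQut G}
    (h : ∀ π : QutRep G, CQut.eval π x = CQut.eval π y) : x = y :=
  Subtype.ext (Subtype.ext (funext h))

theorem CQut.eval_u {V : Type*} [Fintype V] {G : SimpleGraph V} (π : QutRep G) (i j : V) :
    CQut.eval π (CQut.u G i j) = π.u i j := rfl

theorem CQut.isQuantumAutomorphism_u {V : Type*} [Fintype V] (G : SimpleGraph V) :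
    IsQuantumAutomorphism G (CQut.u G) where
  isStarProjection i j := by
    constructor
    · exact CQut.ext_eval fun π =>
        (π.isQuantumAutomorphism.isStarProjection i j).isIdempotentElem
    · exact CQut.ext_eval fun π => (π.isQuantumAutomorphism.isStarProjection i j).isSelfAdjoint
  row_sum i := CQut.ext_eval fun π => by
    simpa only [map_sum, map_one, CQut.eval_u] using π.isQuantumAutomorphism.row_sum i
  col_sum j := CQut.ext_eval fun π => by
    simpa only [map_sum, map_one, CQut.eval_u] using π.isQuantumAutomorphism.col_sum j
  adj_comm := by
    classical
    ext1 i j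
    refine CQut.ext_eval fun π => ?_
    have := congr_fun (congr_fun π.isQuantumAutomorphism.adj_comm i) j
    simp only [SimpleGraph.adjMatrix_mul_apply, SimpleGraph.mul_adjMatrix_apply, map_sum,
      CQut.eval_u] at this ⊢
    convert this

/-- The universal property of `C(Qut(G))`. (Every C⋆-algebra generated by finitely many elements
has a copy in `Type`.) -/
theorem CQut.existsUnique_hom {V : Type*} [Fintype V] (G : SimpleGraph V) {A : Type}
    [CStarAlgebra A] [Nontrivial A] (v : Matrix V V A) (hv : IsQuantumAutomorphism G v) :
    ∃! φ : CQut G →⋆ₐ[ℂ] A, ∀ i j, φ (CQut.u G i j) = v i j := by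
  have continuous_cstar : ∀ f : CQut G →⋆ₐ[ℂ] A, Continuous f := fun f =>
    AddMonoidHomClass.continuous_of_bound f 1 fun x => by
      simpa only [one_mul] using NonUnitalStarAlgHom.norm_apply_le f x
  refine ⟨CQut.eval ⟨A, v, hv⟩, fun _ _ => rfl, fun φ hφ => ?_⟩
  refine StarAlgHom.ext_topologicalClosure (continuous_cstar φ) (continuous_cstar _) ?_
  refine StarAlgHom.ext_adjoin ?_
  rintro ⟨x, hx⟩ ⟨p, rfl⟩
  exact hφ p.1 p.2

/-- `G` has no quantum symmetry: `C(Qut(G))` is commutative. -/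
def NoQuantumSymmetry {V : Type*} [Fintype V] (G : SimpleGraph V) : Prop :=
  ∀ x y : CQut G, x * y = y * x

/-! ### Quantum isomorphism of graphs -/

/-- Winning condition of the `(G, G')`-isomorphism game: on inputs `xa`, `xb` to Alice and Bob
they answer `ya`, `yb`. -/
def IsoGameWins {V V' : Type*} (G : SimpleGraph V) (G' : SimpleGraph V')
    (xa xb ya yb : V ⊕ V') : Prop :=
  ∃ (ga gb : V) (ga' gb' : V'),
    ((xa = .inl ga ∧ ya = .inr ga') ∨ (xa = .inr ga' ∧ ya = .inl ga)) ∧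
    ((xb = .inl gb ∧ yb = .inr gb') ∨ (xb = .inr gb' ∧ yb = .inl gb)) ∧
    (ga = gb ↔ ga' = gb') ∧ (G.Adj ga gb ↔ G'.Adj ga' gb')

/-- A quantum strategy in the commuting operator framework, with inputs and outputs in `X`:
a unit vector in a Hilbert space, and for every input a POVM for Alice and a POVM for Bob,
such that Alice's operators commute with Bob's. -/
structure CommutingStrategy (X : Type*) [Fintype X] where
  H : Type
  [normed : NormedAddCommGroup H]
  [inner : InnerProductSpace ℂ H]
  [complete : CompleteSpace H]
  ψ : H
  E : X → X → H →L[ℂ] H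
  F : X → X → H →L[ℂ] H
  norm_ψ : ‖ψ‖ = 1
  E_pos : ∀ x y, (E x y).IsPositive
  F_pos : ∀ x y, (F x y).IsPositive
  E_sum : ∀ x, ∑ y, E x y = 1
  F_sum : ∀ x, ∑ y, F x y = 1
  comm : ∀ x y x' y', E x y * F x' y' = F x' y' * E x y

attribute [instance] CommutingStrategy.normed CommutingStrategy.inner CommutingStrategy.complete

/-- The probability of the outputs `ya`, `yb` on the inputs `xa`, `xb` (a nonnegative real number,
written here as a complex number). -/
def CommutingStrategy.prob {X : Type*} [Fintype X] (S : CommutingStrategy X)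
    (xa xb ya yb : X) : ℂ :=
  Inner.inner ℂ S.ψ (S.E xa ya (S.F xb yb S.ψ))

/-- `G` and `G'` are quantum isomorphic: some commuting operator strategy wins the
`(G, G')`-isomorphism game with probability 1 (on every pair of inputs). -/
def QuantumIsomorphic {V V' : Type*} [Fintype V] [Fintype V'] (G : SimpleGraph V)
    (G' : SimpleGraph V') : Prop :=
  ∃ S : CommutingStrategy (V ⊕ V'), ∀ xa xb, open Classical in
    (∑ ya, ∑ yb, if IsoGameWins G G' xa xb ya yb then S.prob xa xb ya yb else 0) = 1

/-! ### Colored graphs and the decoloring procedure -/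

/-- A graph with vertex colors in `K` and edge colors in `C`. The value of `edgeColor` at a pair
that is not an edge plays no role. -/
structure ColoredGraph (V K C : Type*) where
  graph : SimpleGraph V
  vertexColor : V → K
  edgeColor : Sym2 V → C

/-- The vertices of the decolored graph of `G`, when the edges of color `c₀` are kept, a path of
length `n c` is attached to every vertex of color `c`, every edge of color `c ≠ c₀` is subdivided,
and a path of length `m c` is attached to its subdivision vertex. `.inl ⟨v, 0⟩` is the vertex `v`
and `.inl ⟨v, i⟩` the `i`-th vertex on the path attached to it; `.inr ⟨e, 0⟩` is the vertex
subdividing `e` and `.inr ⟨e, i⟩` the `i`-th vertex on the path attached to it. -/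
abbrev DecoloredVertex {V K C : Type*} (G : ColoredGraph V K C) (c₀ : C) (n : K → ℕ) (m : C → ℕ) :
    Type _ :=
  (Σ v : V, Fin (n (G.vertexColor v) + 1)) ⊕
    (Σ e : {e : Sym2 V // e ∈ G.graph.edgeSet ∧ G.edgeColor e ≠ c₀}, Fin (m (G.edgeColor e) + 1))

instance {V K C : Type*} [Fintype V] (G : ColoredGraph V K C) (c₀ : C) (n : K → ℕ) (m : C → ℕ) :
    Fintype (DecoloredVertex G c₀ n m) := Fintype.ofFinite _

/-- Adjacency in the decolored graph. -/
def DecoloredAdj {V K C : Type*} (G : ColoredGraph V K C) (c₀ : C) (n : K → ℕ) (m : C → ℕ) :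
    DecoloredVertex G c₀ n m → DecoloredVertex G c₀ n m → Prop
  | .inl ⟨v, i⟩, .inl ⟨w, j⟩ =>
      (v = w ∧ (i.val + 1 = j.val ∨ j.val + 1 = i.val)) ∨
      (i.val = 0 ∧ j.val = 0 ∧ G.graph.Adj v w ∧ G.edgeColor s(v, w) = c₀)
  | .inl ⟨v, i⟩, .inr ⟨e, j⟩ => i.val = 0 ∧ j.val = 0 ∧ v ∈ e.val
  | .inr ⟨e, j⟩, .inl ⟨v, i⟩ => i.val = 0 ∧ j.val = 0 ∧ v ∈ e.val
  | .inr ⟨e, i⟩, .inr ⟨f, j⟩ => e = f ∧ (i.val + 1 = j.val ∨ j.val + 1 = i.val)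

/-- The (uncolored) decolored graph of the colored graph `G`. -/
def ColoredGraph.decolor {V K C : Type*} (G : ColoredGraph V K C) (c₀ : C) (n : K → ℕ)
    (m : C → ℕ) : SimpleGraph (DecoloredVertex G c₀ n m) where
  Adj := DecoloredAdj G c₀ n m
  symm := ⟨by
    rintro (⟨v, i⟩ | ⟨e, i⟩) (⟨w, j⟩ | ⟨f, j⟩) h
    · rcases h with ⟨h, h'⟩ | ⟨h1, h2, h3, h4⟩
      · exact .inl ⟨h.symm, h'.symm⟩
      · exact .inr ⟨h2, h1, h3.symm, Sym2.eq_swap ▸ h4⟩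
    · exact h
    · exact h
    · exact ⟨h.1.symm, h.2.symm⟩⟩
  loopless := ⟨by
    rintro (⟨v, i⟩ | ⟨e, i⟩) h
    · rcases h with ⟨-, h⟩ | ⟨-, -, h, -⟩
      · omega
      · exact G.graph.loopless.irrefl _ h
    · have := h.2
      omega⟩

/-! ### The colored graphs of a linear system over `𝔽₂` -/

section LinearSystem

variable {K E : Type*} [Fintype E] [DecidableEq E]

/-- `S_k(M)`, the set of variables that occur in the `k`-th equation. -/
def eqnSupport (M : Matrix K E (ZMod 2)) (k : K) : Finset E := {i | M k i = 1}

/-- The vertices `(k, α)`: `α` is a `±1`-valued assignment on the support of the `k`-th equation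
which satisfies that equation, written multiplicatively. -/
abbrev SystemVertex (M : Matrix K E (ZMod 2)) (b : K → ZMod 2) : Type _ :=
  Σ k : K, {α : eqnSupport M k → ℤˣ // ∏ i, α i = (-1) ^ (b k).val}

instance [Fintype K] (M : Matrix K E (ZMod 2)) (b : K → ZMod 2) :
    Fintype (SystemVertex M b) := Fintype.ofFinite _

/-- A function to `±1` on a finite set of variables. -/
abbrev SignFunction (E : Type*) : Type _ := Σ S : Finset E, (S → ℤˣ)

/-- The pointwise product `α △ β` on the intersection of the supports. -/
def signProd {M : Matrix K E (ZMod 2)} {b : K → ZMod 2} (x y : SystemVertex M b) :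
    SignFunction E :=
  ⟨eqnSupport M x.1 ∩ eqnSupport M y.1, fun i =>
    x.2.1 ⟨i, (Finset.mem_inter.1 i.2).1⟩ * y.2.1 ⟨i, (Finset.mem_inter.1 i.2).2⟩⟩

theorem signProd_comm {M : Matrix K E (ZMod 2)} {b : K → ZMod 2} (x y : SystemVertex M b) :
    signProd x y = signProd y x := by
  have key : ∀ (S T : Finset E) (h : S = T) (f : S → ℤˣ) (g : T → ℤˣ),
      (∀ i (hS : i ∈ S) (hT : i ∈ T), f ⟨i, hS⟩ = g ⟨i, hT⟩) →
      (⟨S, f⟩ : SignFunction E) = ⟨T, g⟩ := by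
    rintro S _ rfl f g hfg
    have : f = g := funext fun i => hfg i i.2 i.2
    rw [this]
  exact key _ _ (Finset.inter_comm _ _) _ _ fun i _ _ => mul_comm _ _

/-- The colored graph `G(M, b)`. -/
def systemGraph (M : Matrix K E (ZMod 2)) (b : K → ZMod 2) :
    ColoredGraph (SystemVertex M b) K (SignFunction E) where
  graph :=
    { Adj := fun x y => x ≠ y ∧ (eqnSupport M x.1 ∩ eqnSupport M y.1).Nonempty
      symm := ⟨fun x _ h => ⟨h.1.symm, Finset.inter_comm (eqnSupport M x.1) _ ▸ h.2⟩⟩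
      loopless := ⟨fun _ h => h.1 rfl⟩ }
  vertexColor := Sigma.fst
  edgeColor := Sym2.lift ⟨signProd, signProd_comm⟩

/-- Edge colors after recoloring: a sign for the edges between different `V_l`, `V_k`, and the
original color for the edges inside some `V_k`. -/
abbrev StarColor (E : Type*) : Type _ := ℤˣ ⊕ SignFunction E

/-- The product of all values of a sign function. -/
def SignFunction.total {E : Type*} (f : SignFunction E) : ℤˣ := ∏ i, f.2 i

/-- The recoloring of the edges: the edge between `(l, α)` and `(k, β)` with `l ≠ k` is colored by
the sign `α i * β i`, where `i` is the unique common variable of the equations `l` and `k`, so that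
`SignFunction.total` is a product with one factor. -/
def starColor (M : Matrix K E (ZMod 2)) (b : K → ZMod 2) : Sym2 (SystemVertex M b) → StarColor E :=
  open Classical in
  Sym2.lift ⟨fun x y =>
    if x.1 = y.1 then .inr (signProd x y) else .inl (signProd x y).total, fun x y => by
      beta_reduce
      rw [signProd_comm x y]
      by_cases h : x.1 = y.1
      · rw [if_pos h, if_pos h.symm]
      · rw [if_neg h, if_neg (Ne.symm h)]⟩

/-- The colored graph `G_*(M, b)`, for `M` the incidence matrix of a graph: recolor `G(M, b)` and
replace the edges of color `1` between different `V_l`, `V_k` by non-edges. -/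
def starGraph (M : Matrix K E (ZMod 2)) (b : K → ZMod 2) :
    ColoredGraph (SystemVertex M b) K (StarColor E) where
  graph :=
    { Adj := fun x y => (systemGraph M b).graph.Adj x y ∧ starColor M b s(x, y) ≠ .inl 1
      symm := ⟨fun x _ h => ⟨h.1.symm, Sym2.eq_swap (a := x) ▸ h.2⟩⟩
      loopless := ⟨fun x h => (systemGraph M b).graph.loopless.irrefl x h.1⟩ }
  vertexColor := Sigma.fst
  edgeColor := starColor M b

end LinearSystem

/-- The vertex-edge incidence matrix of a graph `H` over `𝔽₂`, with columns indexed by the edges. -/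
def graphIncidence {K : Type*} (H : SimpleGraph K) : Matrix K H.edgeSet (ZMod 2) :=
  open Classical in (H.incMatrix (ZMod 2)).submatrix id Subtype.val

/-- The incidence matrix of `K_{3,3}`. -/
abbrev incidenceK33 :
    Matrix (Fin 3 ⊕ Fin 3) (completeBipartiteGraph (Fin 3) (Fin 3)).edgeSet (ZMod 2) :=
  graphIncidence (completeBipartiteGraph (Fin 3) (Fin 3))

instance : Fintype (completeBipartiteGraph (Fin 3) (Fin 3)).edgeSet := Fintype.ofFinite _

end

/-! All three assertions concern matrices `u` satisfying `IsQuantumIso`. Over ℂ they include the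
graph isomorphisms, over `CQut G` the fundamental representation, and over complex matrices, with
self-adjoint entries, they give perfect strategies.

Rigidity. A nonzero entry can only match vertices with the same local invariants. Original vertices
have degree at least four in the decolored graph, all others at most three, and path lengths encode
the colors. So `u` restricts to a quantum isomorphism `w` of colored graphs
(`IsQuantumIso.isColoredQuantumIso`). For a variable e put X_e = Σ α_e α'_e w(α, α'), summed over
α'. The colored graph records exactly the products α_e β_e, so X_e does not depend on the chosen (k,
α) with e in S_k. The X_e are involutions, commute within an equation and multiply over equation k
to (-1)^(b_k + b'_k) (`exists_operator_solution`).

For K_{3,3} the nine variables form a 3 × 3 square whose rows and columns are the equations. If b =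
b', all X_e commute (`magicSquare_commute`); the entries of `w` are polynomials in them, and the
remaining entries of `u` are determined by `w` (`decolored_commute`), so there is no quantum
symmetry. Over ℂ, multiplying the square by rows and by columns gives the same number, so the signs
(-1)^(b_k + b'_k) multiply to 1, which excludes an isomorphism when b = 0 and b' has a single 1.

Construction. If the signs multiply to -1, the Mermin–Peres square, after changes of sign, is an
operator solution. It has a joint spectral projection q_ω for every vertex ω = (k, α) of G_*(M, b),
and translation by α carries the part of the graph over equation k from right-hand side 0 to b. Let
u(x, x') be the sum of the q_ω over those ω that carry x to x'. If q_ω q_ω' ≠ 0, then ω and ω' agree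
on common variables, and such translations respect adjacency (`isQuantumIso_translationUnitary`). -/

/-! ### Quantum isomorphisms over a ring and their invariants -/

/-- `u` is a quantum isomorphism from `G` to `G'` over the algebra `A`: a magic unitary compatible
with equality and adjacency. -/
structure IsQuantumIso {V V' : Type*} [Fintype V] [Fintype V'] (G : SimpleGraph V)
    (G' : SimpleGraph V') {A : Type*} [Ring A] (u : V → V' → A) : Prop where
  row_sum : ∀ x, ∑ x', u x x' = 1
  col_sum : ∀ x', ∑ x, u x x' = 1
  compat : ∀ {x y x' y'}, u x x' * u y y' ≠ 0 →
    ((x = y ↔ x' = y') ∧ (G.Adj x y ↔ G'.Adj x' y'))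

namespace IsQuantumIso

variable {V V' : Type*} [Fintype V] [Fintype V'] {G : SimpleGraph V}
    {G' : SimpleGraph V'} {A : Type*} [Ring A] {u : V → V' → A}

theorem symm (hu : IsQuantumIso G G' u) : IsQuantumIso G' G fun x' x => u x x' where
  row_sum := hu.col_sum
  col_sum := hu.row_sum
  compat h := ⟨(hu.compat h).1.symm, (hu.compat h).2.symm⟩

theorem mul_self (hu : IsQuantumIso G G' u) (x : V) (x' : V') : u x x' * u x x' = u x x' := by
  conv_rhs => rw [← mul_one (u x x'), ← hu.row_sum x, Finset.mul_sum]
  rw [Finset.sum_eq_single x' (fun y' _ hy' => by_contra fun h => hy' ((hu.compat h).1.1 rfl).symm)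
    (fun h => absurd (Finset.mem_univ _) h)]

theorem exists_right (hu : IsQuantumIso G G' u) {a : A} (ha : a ≠ 0) (y : V) :
    ∃ y', a * u y y' ≠ 0 := by
  by_contra! h
  apply ha
  rw [← mul_one a, ← hu.row_sum y, Finset.mul_sum]
  exact Finset.sum_eq_zero fun y' _ => h y'

theorem exists_mid (hu : IsQuantumIso G G' u) {a b : A} (ha : a * b ≠ 0) (y : V) :
    ∃ y', a * u y y' * b ≠ 0 := by
  by_contra! h
  apply ha
  rw [← mul_one a, ← hu.row_sum y, Finset.mul_sum, Finset.sum_mul]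
  exact Finset.sum_eq_zero fun y' _ => h y'

/-- Existence of a neighbor with an invariant property is invariant (one direction). -/
theorem exists_adj (hu : IsQuantumIso G G' u) {c : V → Prop} {c' : V' → Prop}
    (hc : ∀ y y', u y y' ≠ 0 → c y → c' y') {x : V} {x' : V'} (h : u x x' ≠ 0)
    (hx : ∃ y, G.Adj x y ∧ c y) : ∃ y', G'.Adj x' y' ∧ c' y' := by
  obtain ⟨y, hxy, hy⟩ := hx
  obtain ⟨y', hy'⟩ := hu.exists_right h y
  exact ⟨y', (hu.compat hy').2.1 hxy, hc y y' (right_ne_zero_of_mul hy') hy⟩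

theorem exists_adj_iff (hu : IsQuantumIso G G' u) {c : V → Prop} {c' : V' → Prop}
    (hc : ∀ y y', u y y' ≠ 0 → (c y ↔ c' y')) {x : V} {x' : V'} (h : u x x' ≠ 0) :
    (∃ y, G.Adj x y ∧ c y) ↔ ∃ y', G'.Adj x' y' ∧ c' y' :=
  ⟨hu.exists_adj (fun y y' h => (hc y y' h).1) h,
    hu.symm.exists_adj (fun y' y h => (hc y y' h).2) h⟩

open Classical in
/-- The number of neighbors with an invariant property is invariant. -/
theorem card_adj_eq [Algebra ℂ A] (hu : IsQuantumIso G G' u) {c : V → Prop} {c' : V' → Prop}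
    (hc : ∀ y y', u y y' ≠ 0 → (c y ↔ c' y')) {x : V} {x' : V'} (h : u x x' ≠ 0) :
    {y | G.Adj x y ∧ c y}.ncard = {y' | G'.Adj x' y' ∧ c' y'}.ncard := by
  rw [← Finset.coe_filter_univ, ← Finset.coe_filter_univ, Set.ncard_coe_finset,
    Set.ncard_coe_finset]
  have key : ∀ y y', u x x' * u y y' ≠ 0 → ((G.Adj x y ∧ c y) ↔ (G'.Adj x' y' ∧ c' y')) :=
    fun y y' hy => and_congr (hu.compat hy).2 (hc y y' (right_ne_zero_of_mul hy))
  have h1 : ((Finset.univ.filter fun y => G.Adj x y ∧ c y).card : ℂ) • u x x' =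
      ∑ y, ∑ y', if G.Adj x y ∧ c y then u x x' * u y y' else 0 := by
    have : ∀ y, (∑ y', if G.Adj x y ∧ c y then u x x' * u y y' else 0) =
        if G.Adj x y ∧ c y then u x x' else 0 := by
      intro y
      split_ifs
      · rw [← Finset.mul_sum, hu.row_sum, mul_one]
      · simp
    simp_rw [this]
    rw [← Finset.sum_filter, Finset.sum_const, Nat.cast_smul_eq_nsmul]
  have h2 : ((Finset.univ.filter fun y' => G'.Adj x' y' ∧ c' y').card : ℂ) • u x x' =
      ∑ y, ∑ y', if G'.Adj x' y' ∧ c' y' then u x x' * u y y' else 0 := by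
    rw [Finset.sum_comm]
    have : ∀ y', (∑ y, if G'.Adj x' y' ∧ c' y' then u x x' * u y y' else 0) =
        if G'.Adj x' y' ∧ c' y' then u x x' else 0 := by
      intro y
      split_ifs
      · rw [← Finset.mul_sum, hu.col_sum, mul_one]
      · simp
    simp_rw [this]
    rw [← Finset.sum_filter, Finset.sum_const, Nat.cast_smul_eq_nsmul]
  have h3 : (∑ y, ∑ y', if G.Adj x y ∧ c y then u x x' * u y y' else 0) =
      ∑ y, ∑ y', if G'.Adj x' y' ∧ c' y' then u x x' * u y y' else 0 := by
    refine Finset.sum_congr rfl fun y _ => Finset.sum_congr rfl fun y' _ => ?_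
    by_cases hy : u x x' * u y y' = 0
    · simp [hy]
    · simp only [key y y' hy]
  -- Both counts multiply the nonzero element `u x x'` to the same result; scalars from ℂ can be
  -- cancelled.
  rw [← h1, ← h2, ← sub_eq_zero, ← sub_smul, smul_eq_zero, or_iff_left h, sub_eq_zero] at h3
  exact_mod_cast h3

/-- Two entries agree if the two vertices determine each other on both sides. -/
theorem entry_eq (hu : IsQuantumIso G G' u) {x y : V} {x' y' : V'}
    (hy : ∀ z', u x x' * u y z' ≠ 0 → z' = y') (hx : ∀ z', u x z' * u y y' ≠ 0 → z' = x') :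
    u x x' = u y y' := by
  -- Both entries equal the product `u x x' * u y y'`: insert a row sum equal to `1` on either side;
  -- one term survives.
  have h1 : u x x' = u x x' * u y y' := by
    conv_lhs => rw [← mul_one (u x x'), ← hu.row_sum y, Finset.mul_sum]
    exact Finset.sum_eq_single y' (fun z' _ hz => by_contra fun h => hz (hy z' h)) (by simp)
  rw [h1]
  conv_rhs => rw [← one_mul (u y y'), ← hu.row_sum x, Finset.sum_mul]
  exact (Finset.sum_eq_single x' (fun z' _ hz => by_contra fun h => hz (hx z' h)) (by simp)).symm

open Classical in
theorem of_iso (φ : G ≃g G') : IsQuantumIso G G' fun x x' => if φ x = x' then (1 : ℂ) else 0 where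
  row_sum x := by
    rw [Finset.sum_eq_single (φ x) (fun z _ hz => if_neg hz.symm)
      (fun h => absurd (Finset.mem_univ _) h), if_pos rfl]
  col_sum x' := by
    rw [Finset.sum_eq_single (φ.symm x')
      (fun z _ hz => if_neg fun h => hz (by rw [← h, RelIso.symm_apply_apply]))
      (fun h => absurd (Finset.mem_univ _) h), if_pos (RelIso.apply_symm_apply _ _)]
  compat {x y x' y'} h := by
    have h1 : φ x = x' := by
      by_contra h1
      exact h (by simp [h1])
    have h2 : φ y = y' := by
      by_contra h1
      exact h (by simp [h1])
    subst h1 h2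
    exact ⟨φ.injective.eq_iff.symm, φ.map_adj_iff.symm⟩

end IsQuantumIso

/-! ### From the C⋆-algebraic relations to quantum isomorphisms -/

/-- Projections of a C⋆-algebra that sum to `1` are pairwise orthogonal. -/
theorem IsStarProjection.mul_eq_zero_of_sum_eq_one {A ι : Type*} [CStarAlgebra A] [Fintype ι]
    {p : ι → A} (hp : ∀ i, IsStarProjection (p i)) (h : ∑ i, p i = 1) {i j : ι} (hij : i ≠ j) :
    p i * p j = 0 := by
  classical
  let _ := CStarAlgebra.spectralOrder A
  have _ := CStarAlgebra.spectralOrderedRing A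
  -- Compressing Σ p_l = 1 by p_i leaves Σ_{l ≠ i} p_i p_l p_i = 0. The summands are positive, so
  -- each vanishes.
  have hs : ∑ l ∈ Finset.univ.erase i, star (p l * p i) * (p l * p i) = 0 := by
    have e : ∀ l, star (p l * p i) * (p l * p i) = p i * p l * p i := fun l => by
      rw [star_mul, (hp l).isSelfAdjoint.star_eq, (hp i).isSelfAdjoint.star_eq, mul_assoc,
        ← mul_assoc (p l), (hp l).isIdempotentElem.eq, mul_assoc]
    have h1 : ∑ l, p i * p l * p i = p i := by
      rw [← Finset.sum_mul, ← Finset.mul_sum, h, mul_one, (hp i).isIdempotentElem.eq]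
    rw [← Finset.add_sum_erase _ _ (Finset.mem_univ i), (hp i).isIdempotentElem.eq,
      (hp i).isIdempotentElem.eq] at h1
    simpa only [e, add_eq_left] using h1
  rw [Finset.sum_eq_zero_iff_of_nonneg fun l _ => star_mul_self_nonneg _] at hs
  have := hs j (by simp [hij.symm])
  rw [CStarRing.star_mul_self_eq_zero_iff] at this
  have h2 := congrArg star this
  rwa [star_mul, (hp i).isSelfAdjoint.star_eq, (hp j).isSelfAdjoint.star_eq, star_zero] at h2

/-- Equality is respected because the projections in a row or column are orthogonal. For adjacency,
sandwich the (x, y') entry of Au = uA between `u x x'` and `u y y'`: one side retains the product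
exactly if x ~ y, the other exactly if x' ~ y'. -/
theorem IsQuantumAutomorphism.isQuantumIso {V : Type*} [Fintype V] {G : SimpleGraph V}
    {A : Type*} [CStarAlgebra A] {u : Matrix V V A} (hu : IsQuantumAutomorphism G u) :
    IsQuantumIso G G u where
  row_sum := hu.row_sum
  col_sum := hu.col_sum
  compat {x y x' y'} := by
    classical
    have hrow : ∀ x {x' y'}, x' ≠ y' → u x x' * u x y' = 0 := fun x _ _ h =>
      IsStarProjection.mul_eq_zero_of_sum_eq_one (hu.isStarProjection x) (hu.row_sum x) h
    have hcol : ∀ x' {x y}, x ≠ y → u x x' * u y x' = 0 := fun x' _ _ h =>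
      IsStarProjection.mul_eq_zero_of_sum_eq_one (fun x => hu.isStarProjection x x')
        (hu.col_sum x') h
    have hadj : ∑ z ∈ G.neighborFinset x, u z y' = ∑ z' ∈ G.neighborFinset y', u x z' := by
      have := congr_fun (congr_fun hu.adj_comm x) y'
      rw [SimpleGraph.adjMatrix_mul_apply, SimpleGraph.mul_adjMatrix_apply] at this
      convert this
    have hid : ∀ x x', u x x' * u x x' = u x x' := fun x x' =>
      (hu.isStarProjection x x').isIdempotentElem.eq
    have hl : (∑ z ∈ G.neighborFinset x, u z y') * u y y' = if G.Adj x y then u y y' else 0 := by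
      rw [Finset.sum_mul]
      split_ifs with h
      · rw [Finset.sum_eq_single y (fun z _ hz => hcol y' hz) (by simp [h]), hid]
      · refine Finset.sum_eq_zero fun z hz => hcol y' ?_
        rintro rfl
        simp [h] at hz
    have hr : u x x' * (∑ z' ∈ G.neighborFinset y', u x z') =
        if G.Adj x' y' then u x x' else 0 := by
      rw [Finset.mul_sum]
      split_ifs with h
      · rw [Finset.sum_eq_single x' (fun z _ hz => hrow x hz.symm) (by simp [h.symm]), hid]
      · refine Finset.sum_eq_zero fun z hz => hrow x ?_
        rintro rfl
        simp [G.adj_comm, h] at hz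
    have key : (u x x' * if G.Adj x y then u y y' else 0) =
        (if G.Adj x' y' then u x x' else 0) * u y y' := by
      rw [← hl, ← hr, hadj, mul_assoc]
    refine fun h => ⟨⟨?_, ?_⟩, ⟨?_, ?_⟩⟩
    · rintro rfl
      exact by_contra fun h' => h (hrow x h')
    · rintro rfl
      exact by_contra fun h' => h (hcol x' h')
    · intro h1
      by_contra h2
      exact h (by simpa [h1, h2] using key)
    · intro h1
      by_contra h2
      exact h (by simpa [h1, h2] using key.symm)

/-- `G` has no quantum symmetry as soon as the generators of `C(Qut(G))` commute. -/
theorem noQuantumSymmetry_of_commute {V : Type*} [Fintype V] {G : SimpleGraph V}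
    (h : ∀ i j k l, Commute (CQut.u G i j) (CQut.u G k l)) : NoQuantumSymmetry G := by
  have hc : ∀ x ∈ Set.range fun p : V × V => qutGen G p.1 p.2,
      ∀ y ∈ Set.range fun p : V × V => qutGen G p.1 p.2, x * y = y * x := by
    rintro _ ⟨p, rfl⟩ _ ⟨q, rfl⟩
    exact congrArg Subtype.val (h p.1 p.2 q.1 q.2)
  have hs : ∀ x ∈ Set.range fun p : V × V => qutGen G p.1 p.2,
      ∀ y ∈ Set.range fun p : V × V => qutGen G p.1 p.2, x * star y = star y * x := by
    rintro x hx _ ⟨q, rfl⟩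
    have : star (qutGen G q.1 q.2) = qutGen G q.1 q.2 := congrArg Subtype.val
      ((CQut.isQuantumAutomorphism_u G).isStarProjection q.1 q.2).isSelfAdjoint.star_eq
    simp only [this]
    exact hc x hx _ ⟨q, rfl⟩
  have _ := StarAlgebra.isMulCommutative_adjoin ℂ hc hs
  have h1 : ∀ x y : StarAlgebra.adjoin ℂ (Set.range fun p : V × V => qutGen G p.1 p.2),
      x * y = y * x := fun x y => mul_comm' x y
  exact (StarSubalgebra.commRingTopologicalClosure _ h1).mul_comm

/-- `w` is a quantum isomorphism of colored graphs. -/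
structure IsColoredQuantumIso {V V' K C : Type*} [Fintype V] [Fintype V']
    (G : ColoredGraph V K C) (G' : ColoredGraph V' K C) {A : Type*} [Ring A]
    (w : V → V' → A) : Prop where
  row_sum : ∀ v, ∑ v', w v v' = 1
  col_sum : ∀ v', ∑ v, w v v' = 1
  vertexColor_eq : ∀ {v v'}, w v v' ≠ 0 → G.vertexColor v = G'.vertexColor v'
  compat : ∀ {v z v' z'}, w v v' * w z z' ≠ 0 →
    ((v = z ↔ v' = z') ∧ (G.graph.Adj v z ↔ G'.graph.Adj v' z') ∧
      (G.graph.Adj v z → G.edgeColor s(v, z) = G'.edgeColor s(v', z')))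

/-! ### Local structure of the decolored graph -/

section Decolored

variable {V K C : Type*} {G : ColoredGraph V K C} {c₀ : C} {n : K → ℕ} {m : C → ℕ}

/-- Whether a vertex of the decolored graph belongs to a vertex (`true`) or an edge (`false`), and
its position on the attached path. -/
def decoloredTag : DecoloredVertex G c₀ n m → Bool × ℕ
  | .inl ⟨_, i⟩ => (true, i)
  | .inr ⟨_, i⟩ => (false, i)

/-- The length of the path that contains a vertex of the decolored graph. -/
def decoloredLength : DecoloredVertex G c₀ n m → ℕ
  | .inl ⟨v, _⟩ => n (G.vertexColor v)
  | .inr ⟨e, _⟩ => m (G.edgeColor e)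

/-- The color of the vertex or edge that a vertex of the decolored graph belongs to. -/
def decoloredColor : DecoloredVertex G c₀ n m → K ⊕ C
  | .inl ⟨v, _⟩ => .inl (G.vertexColor v)
  | .inr ⟨e, _⟩ => .inr (G.edgeColor e)

/-- A vertex of a colored graph as a vertex of the decolored graph. -/
abbrev decoloredRoot (v : V) : DecoloredVertex G c₀ n m := .inl ⟨v, 0⟩

theorem decoloredTag_snd_le (x : DecoloredVertex G c₀ n m) :
    (decoloredTag x).2 ≤ decoloredLength x := by
  rcases x with ⟨v, i⟩ | ⟨e, i⟩
  · exact Nat.lt_succ_iff.1 i.2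
  · exact Nat.lt_succ_iff.1 i.2

theorem decolored_inl_ext {v w : V} {i j} (h : v = w) (hij : i.val = j.val) :
    (.inl ⟨v, i⟩ : DecoloredVertex G c₀ n m) = .inl ⟨w, j⟩ := by
  subst h
  rw [Fin.ext hij]

theorem decolored_inr_ext {e f : {e : Sym2 V // e ∈ G.graph.edgeSet ∧ G.edgeColor e ≠ c₀}} {i j}
    (h : e = f) (hij : i.val = j.val) :
    (.inr ⟨e, i⟩ : DecoloredVertex G c₀ n m) = .inr ⟨f, j⟩ := by
  subst h
  rw [Fin.ext hij]

theorem decoloredRoot_inj {v z : V} :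
    (decoloredRoot v : DecoloredVertex G c₀ n m) = decoloredRoot z ↔ v = z :=
  ⟨fun h => congrArg Sigma.fst (Sum.inl.inj h), fun h => by rw [h]⟩

theorem eq_decoloredRoot {x : DecoloredVertex G c₀ n m} (h : decoloredTag x = (true, 0)) :
    ∃ v, x = decoloredRoot v := by
  rcases x with ⟨v, i⟩ | ⟨e, i⟩
  · exact ⟨v, decolored_inl_ext rfl (congrArg Prod.snd h)⟩
  · simp [decoloredTag] at h

theorem decolor_adj_inl_inl {v w : V} {i j} :
    (G.decolor c₀ n m).Adj (.inl ⟨v, i⟩) (.inl ⟨w, j⟩) ↔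
      (v = w ∧ (i.val + 1 = j.val ∨ j.val + 1 = i.val)) ∨
      (i.val = 0 ∧ j.val = 0 ∧ G.graph.Adj v w ∧ G.edgeColor s(v, w) = c₀) := Iff.rfl

theorem decolor_adj_inl_inr {v : V} {e i j} :
    (G.decolor c₀ n m).Adj (.inl ⟨v, i⟩) (.inr ⟨e, j⟩) ↔
      i.val = 0 ∧ j.val = 0 ∧ v ∈ e.val := Iff.rfl

theorem decolor_adj_inr_inl {v : V} {e i j} :
    (G.decolor c₀ n m).Adj (.inr ⟨e, j⟩) (.inl ⟨v, i⟩) ↔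
      i.val = 0 ∧ j.val = 0 ∧ v ∈ e.val := Iff.rfl

theorem decolor_adj_inr_inr {e f i j} :
    (G.decolor c₀ n m).Adj (.inr ⟨e, i⟩) (.inr ⟨f, j⟩) ↔
      e = f ∧ (i.val + 1 = j.val ∨ j.val + 1 = i.val) := Iff.rfl

theorem decolor_adj_root {v w : V} :
    (G.decolor c₀ n m).Adj (decoloredRoot v) (decoloredRoot w) ↔
      G.graph.Adj v w ∧ G.edgeColor s(v, w) = c₀ := by
  simp [decolor_adj_inl_inl]

/-- Describes position `h + 1` through earlier positions and adjacency only, which allows induction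
along paths. Excluding both kinds of position 0 removes the neighbors of a path's base that lie off
the path; excluding smaller positions removes the predecessor. -/
theorem decoloredTag_succ_iff (x : DecoloredVertex G c₀ n m) (κ : Bool) (h : ℕ) :
    decoloredTag x = (κ, h + 1) ↔ decoloredTag x ≠ (true, 0) ∧ decoloredTag x ≠ (false, 0) ∧
      (∀ j < h + 1, decoloredTag x ≠ (κ, j)) ∧
      ∃ y, (G.decolor c₀ n m).Adj x y ∧ decoloredTag y = (κ, h) := by
  constructor
  · intro hx
    refine ⟨by simp [hx], by simp [hx], fun j hj => by simp [hx]; omega, ?_⟩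
    rcases x with ⟨v, i⟩ | ⟨e, i⟩
    · simp only [decoloredTag, Prod.mk.injEq] at hx
      exact ⟨.inl ⟨v, ⟨h, by omega⟩⟩, .inl ⟨rfl, .inr hx.2.symm⟩, by simp [decoloredTag, hx]⟩
    · simp only [decoloredTag, Prod.mk.injEq] at hx
      exact ⟨.inr ⟨e, ⟨h, by omega⟩⟩, ⟨rfl, .inr hx.2.symm⟩, by simp [decoloredTag, hx]⟩
  · rintro ⟨h1, h2, h3, y, hxy, hy⟩
    rcases x with ⟨v, i⟩ | ⟨e, i⟩ <;> rcases y with ⟨w, j⟩ | ⟨f, j⟩ <;>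
      simp only [decoloredTag, decolor_adj_inl_inl, decolor_adj_inl_inr, decolor_adj_inr_inl,
        decolor_adj_inr_inr, Prod.mk.injEq, ne_eq, true_and, not_and] at * <;>
      obtain ⟨rfl, rfl⟩ := hy
    · simp only [true_and, forall_const] at *
      have := h3 i
      omega
    · tauto
    · tauto
    · simp only [true_and, forall_const] at *
      have := h3 i
      omega

/-- A neighbor at the next position lies on the same path, so lower bounds on the length can be
tested by walking outward. -/
theorem decoloredLength_succ_iff {x : DecoloredVertex G c₀ n m} {κ : Bool} {h : ℕ}
    (hx : decoloredTag x = (κ, h)) (r : ℕ) :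
    (∃ y, (G.decolor c₀ n m).Adj x y ∧
      (decoloredTag y = (κ, h + 1) ∧ h + 1 + r ≤ decoloredLength y)) ↔
    h + (r + 1) ≤ decoloredLength x := by
  constructor
  · rintro ⟨y, hxy, hy, hl⟩
    rcases x with ⟨v, i⟩ | ⟨e, i⟩ <;> rcases y with ⟨w, j⟩ | ⟨f, j⟩ <;>
      simp only [decoloredTag, decoloredLength, decolor_adj_inl_inl, decolor_adj_inl_inr,
        decolor_adj_inr_inl, decolor_adj_inr_inr, Prod.mk.injEq] at *
    · obtain ⟨rfl, -⟩ | h := hxy <;> omega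
    · have := hx.1.trans hy.1.symm
      simp at this
    · have := hx.1.trans hy.1.symm
      simp at this
    · obtain ⟨rfl, -⟩ := hxy
      omega
  · intro hl
    rcases x with ⟨v, i⟩ | ⟨e, i⟩ <;> simp only [decoloredTag, decoloredLength, Prod.mk.injEq] at *
    · exact ⟨.inl ⟨v, ⟨h + 1, by omega⟩⟩, .inl ⟨rfl, .inl (by simp [hx.2])⟩,
        by simp [hx.1], by simp only; omega⟩
    · exact ⟨.inr ⟨e, ⟨h + 1, by omega⟩⟩, ⟨rfl, .inl (by simp [hx.2])⟩,
        by simp [hx.1], by simp only; omega⟩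

/-- A path vertex has at most two neighbors; a subdivision vertex has two endpoints and at most one
path vertex. The conjunct `True` is the trivial invariant property for `IsQuantumIso.card_adj_eq`.
-/
theorem card_adj_le_three {x : DecoloredVertex G c₀ n m} (hx : decoloredTag x ≠ (true, 0)) :
    {y | (G.decolor c₀ n m).Adj x y ∧ True}.ncard ≤ 3 := by
  classical
  rcases x with ⟨v, i⟩ | ⟨e, i⟩
  · have hi : i.val ≠ 0 := by simpa [decoloredTag] using hx
    refine le_trans (Set.ncard_le_ncard_of_injOn (t := ({(true, i.val - 1), (true, i.val + 1)} :
      Finset _)) decoloredTag ?_ ?_ (Finset.finite_toSet _)) ?_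
    · rintro (⟨w, j⟩ | ⟨f, j⟩) hy <;>
        simp [decoloredTag, decolor_adj_inl_inl, decolor_adj_inl_inr, hi] at hy ⊢
      omega
    · rintro (⟨w, j⟩ | ⟨f, j⟩) hy (⟨w', j'⟩ | ⟨f', j'⟩) hy' hyy' <;>
        simp [decoloredTag, decolor_adj_inl_inl, decolor_adj_inl_inr, hi, -Sum.inl.injEq]
          at hy hy' hyy' ⊢
      exact decolored_inl_ext (hy.1.symm.trans hy'.1) hyy'
    · rw [Set.ncard_coe_finset]
      exact Finset.card_le_two.trans (by omega)
  · obtain ⟨⟨v, w⟩, he⟩ := e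
    refine le_trans (Set.ncard_le_ncard_of_injOn (t := (if i.val = 0 then {.inl v, .inl w, .inr 1}
      else {.inr (i.val - 1), .inr (i.val + 1)} : Finset (V ⊕ ℕ)))
      (fun y => (match y with
        | .inl ⟨z, _⟩ => .inl z
        | .inr ⟨_, j⟩ => .inr j.val : V ⊕ ℕ)) ?_ ?_ (Finset.finite_toSet _)) ?_
    · rintro (⟨w, j⟩ | ⟨f, j⟩) hy
      · have hy := decolor_adj_inr_inl.1 hy.1
        simpa [hy.2.1] using hy.2.2
      · have hy := decolor_adj_inr_inr.1 hy.1
        split_ifs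
        · simp
          omega
        · simp
          omega
    · rintro (⟨w, j⟩ | ⟨f, j⟩) hy (⟨w', j'⟩ | ⟨f', j'⟩) hy' hyy' <;>
        simp [decolor_adj_inr_inl, decolor_adj_inr_inr, -Sum.inl.injEq,
          -Sum.inr.injEq] at hy hy' hyy' ⊢
      · exact decolored_inl_ext (Sum.inl.inj hyy') (by simp [hy, hy'])
      · exact decolored_inr_ext (hy.1.symm.trans hy'.1) (Sum.inr.inj hyy')
    · rw [Set.ncard_coe_finset]
      split_ifs
      · exact Finset.card_le_three
      · exact Finset.card_le_two.trans (by omega)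

/-- A subdivision vertex sees its two distinct endpoints, whereas a vertex further along a path sees
at most one original vertex. -/
theorem decoloredTag_eq_false_zero_iff [Fintype V] (x : DecoloredVertex G c₀ n m) :
    decoloredTag x = (false, 0) ↔ decoloredTag x ≠ (true, 0) ∧
      1 < {y | (G.decolor c₀ n m).Adj x y ∧ decoloredTag y = (true, 0)}.ncard := by
  rw [Set.one_lt_ncard (Set.toFinite _)]
  constructor
  · intro hx
    refine ⟨by simp [hx], ?_⟩
    rcases x with ⟨v, i⟩ | ⟨⟨⟨v, w⟩, he⟩, i⟩
    · simp [decoloredTag] at hx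
    have hi : i.val = 0 := by simpa [decoloredTag] using hx
    have hvw : v ≠ w := G.graph.ne_of_adj he.1
    exact ⟨decoloredRoot v, ⟨⟨rfl, hi, Sym2.mem_mk_left _ _⟩, rfl⟩,
      decoloredRoot w, ⟨⟨rfl, hi, Sym2.mem_mk_right _ _⟩, rfl⟩,
      fun h => hvw (congrArg Sigma.fst (Sum.inl.inj h))⟩
  · rintro ⟨hx, y, hy, z, hz, hyz⟩
    by_contra hx'
    apply hyz
    obtain ⟨y, rfl⟩ := eq_decoloredRoot hy.2
    obtain ⟨z, rfl⟩ := eq_decoloredRoot hz.2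
    have hy := hy.1
    have hz := hz.1
    rcases x with ⟨v, i⟩ | ⟨e, i⟩
    · have hx : i.val ≠ 0 := fun h => hx (by simp [decoloredTag, h])
      rw [decolor_adj_inl_inl, or_iff_left (fun h => hx h.1)] at hy hz
      exact decolored_inl_ext (hy.1.symm.trans hz.1) rfl
    · simp only [decoloredTag, Prod.mk.injEq, true_and] at hx'
      exact absurd hy.2.1 hx'

end Decolored

/-! ### Quantum isomorphisms of decolored graphs recover the coloring -/

section QuantumIso

variable {V V' K C : Type*} [Fintype V] [Fintype V'] {G : ColoredGraph V K C}
  {G' : ColoredGraph V' K C} {c₀ : C} {n : K → ℕ} {m : C → ℕ} {A : Type*} [Ring A]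
  {u : DecoloredVertex G c₀ n m → DecoloredVertex G' c₀ n m → A}

/-- All vertices of the colored graph have degree at least four in the decolored graph. -/
def FourLeDegree (G : ColoredGraph V K C) (c₀ : C) (n : K → ℕ) (m : C → ℕ) : Prop :=
  ∀ v, 4 ≤ {y | (G.decolor c₀ n m).Adj (decoloredRoot v) y ∧ True}.ncard

/-- Degree singles out the original vertices, the number of original neighbors singles out the
subdivision vertices, and induction on the position handles the paths. -/
theorem decoloredTag_eq [Algebra ℂ A] (hu : IsQuantumIso (G.decolor c₀ n m) (G'.decolor c₀ n m) u)
    (hG : FourLeDegree G c₀ n m) (hG' : FourLeDegree G' c₀ n m) {x x'} (h : u x x' ≠ 0) :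
    decoloredTag x = decoloredTag x' := by
  classical
  have root : ∀ x x', u x x' ≠ 0 → (decoloredTag x = (true, 0) ↔ decoloredTag x' = (true, 0)) := by
    intro x x' h
    have hc := hu.card_adj_eq (c := fun _ => True) (c' := fun _ => True) (fun _ _ _ => Iff.rfl) h
    constructor
    · intro hx
      by_contra hx'
      obtain ⟨v, rfl⟩ := eq_decoloredRoot hx
      have h1 := hG v
      have h2 := card_adj_le_three hx'
      omega
    · intro hx'
      by_contra hx
      obtain ⟨v, rfl⟩ := eq_decoloredRoot hx'
      have h1 := hG' v
      have h2 := card_adj_le_three hx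
      omega
  have sub : ∀ x x', u x x' ≠ 0 →
      (decoloredTag x = (false, 0) ↔ decoloredTag x' = (false, 0)) := by
    intro x x' h
    rw [decoloredTag_eq_false_zero_iff, decoloredTag_eq_false_zero_iff, hu.card_adj_eq root h, ne_eq,
      root x x' h]
  have main : ∀ h κ x x', u x x' ≠ 0 →
      (decoloredTag x = (κ, h) ↔ decoloredTag x' = (κ, h)) := by
    intro h
    induction h using Nat.strong_induction_on with
    | _ h ih =>
      intro κ
      cases h with
      | zero => cases κ
                · exact sub
                · exact root
      | succ h =>
        intro x x' hx
        rw [decoloredTag_succ_iff, decoloredTag_succ_iff, hu.exists_adj_iff (ih h (by omega) κ) hx,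
          ne_eq, ne_eq, root x x' hx, sub x x' hx]
        refine and_congr_right fun _ => and_congr_right fun _ => and_congr_left fun _ => ?_
        exact forall_congr' fun j => forall_congr' fun hj => not_congr (ih j hj κ x x' hx)
  exact ((main _ _ x x' h).1 rfl).symm

variable [Algebra ℂ A] (hu : IsQuantumIso (G.decolor c₀ n m) (G'.decolor c₀ n m) u)
  (hG : FourLeDegree G c₀ n m) (hG' : FourLeDegree G' c₀ n m)
include hu hG hG'

theorem decoloredLength_eq {x x'} (h : u x x' ≠ 0) : decoloredLength x = decoloredLength x' := by
  have main : ∀ r κ h x x', u x x' ≠ 0 → decoloredTag x = (κ, h) →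
      (h + r ≤ decoloredLength x ↔ h + r ≤ decoloredLength x') := by
    intro r
    induction r with
    | zero =>
      intro κ h x x' hx ht
      have ht' := (decoloredTag_eq hu hG hG' hx).symm.trans ht
      have h1 := decoloredTag_snd_le x
      have h2 := decoloredTag_snd_le x'
      rw [ht] at h1
      rw [ht'] at h2
      exact iff_of_true h1 h2
    | succ r ih =>
      intro κ h x x' hx ht
      have ht' := (decoloredTag_eq hu hG hG' hx).symm.trans ht
      rw [← decoloredLength_succ_iff ht, ← decoloredLength_succ_iff ht']
      refine hu.exists_adj_iff (fun y y' hy => ?_) hx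
      rw [← decoloredTag_eq hu hG hG' hy]
      exact and_congr_right fun hty => ih κ (h + 1) y y' hy hty
  have h1 := decoloredTag_snd_le x
  have h2 := decoloredTag_snd_le x'
  rw [← decoloredTag_eq hu hG hG' h] at h2
  obtain ⟨⟨κ, i⟩, hi⟩ : ∃ t, decoloredTag x = t := ⟨_, rfl⟩
  rw [hi] at h1 h2
  have h3 := main (decoloredLength x - i) _ _ x x' h hi
  have h4 := main (decoloredLength x' - i) _ _ x x' h hi
  rw [Nat.add_sub_cancel' h1] at h3
  rw [Nat.add_sub_cancel' h2] at h4
  exact le_antisymm (h3.1 le_rfl) (h4.2 le_rfl)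

variable (hn : Function.Injective n) (hm : Set.InjOn m {c | c ≠ c₀})
include hn hm

theorem decoloredColor_eq {x x'} (h : u x x' ≠ 0) : decoloredColor x = decoloredColor x' := by
  have h1 := decoloredTag_eq hu hG hG' h
  have h2 := decoloredLength_eq hu hG hG' h
  rcases x with ⟨v, i⟩ | ⟨e, i⟩ <;> rcases x' with ⟨w, j⟩ | ⟨f, j⟩
  · exact congrArg Sum.inl (hn h2)
  · simp [decoloredTag] at h1
  · simp [decoloredTag] at h1
  · exact congrArg Sum.inr (hm e.2.2 f.2.2 h2)

omit hn hm in
-- Entries between an original vertex and any other kind of vertex vanish, so the block of original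
-- vertices has row sums `1`.
theorem sum_decoloredRoot (a : A) (b : A) (v : V) :
    ∑ v', a * u (decoloredRoot v) (decoloredRoot v') * b = a * b := by
  have : ∑ v', u (decoloredRoot v) (decoloredRoot v') = 1 := by
    rw [← hu.row_sum (decoloredRoot v)]
    refine Fintype.sum_of_injective (fun v' => decoloredRoot v')
      (fun v w h => congrArg Sigma.fst (Sum.inl.inj h)) _ _ (fun x hx => ?_) fun _ => rfl
    by_contra h
    obtain ⟨v', rfl⟩ := eq_decoloredRoot (decoloredTag_eq hu hG hG' h).symm
    exact hx ⟨v', rfl⟩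
  rw [← Finset.sum_mul, ← Finset.mul_sum, this, mul_one]

omit [Algebra ℂ A] hG hG' hn hm in
theorem adj_right_of_mul_ne_zero {x y x' y'} (h : u x x' * u y y' ≠ 0)
    (hxy : (G.decolor c₀ n m).Adj x y) : (G'.decolor c₀ n m).Adj x' y' :=
  (hu.compat h).2.1 hxy

theorem decolored_edge_compat {v z v' z'}
    (h : u (decoloredRoot v) (decoloredRoot v') * u (decoloredRoot z) (decoloredRoot z') ≠ 0)
    (hvz : G.graph.Adj v z) :
    G'.graph.Adj v' z' ∧ G.edgeColor s(v, z) = G'.edgeColor s(v', z') := by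
  by_cases hc : G.edgeColor s(v, z) = c₀
  · have := decolor_adj_root.1 (adj_right_of_mul_ne_zero hu h (decolor_adj_root.2 ⟨hvz, hc⟩))
    exact ⟨this.1, hc.trans this.2.symm⟩
  · let x : DecoloredVertex G c₀ n m := .inr ⟨⟨s(v, z), hvz, hc⟩, 0⟩
    -- Insert the row sum of the subdivision vertex between the two factors. A surviving `x'` is a
    -- subdivision vertex of the same color adjacent to both `v'` and `z'`, hence it subdivides {v',
    -- z'}.
    obtain ⟨x', hx'⟩ := hu.exists_mid h x
    have h1 := left_ne_zero_of_mul hx'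
    have h2 := right_ne_zero_of_mul (mul_assoc (u (decoloredRoot v) (decoloredRoot v')) _ _ ▸ hx')
    have hx := right_ne_zero_of_mul h1
    have a1 := adj_right_of_mul_ne_zero hu h1 ⟨rfl, rfl, Sym2.mem_mk_left _ _⟩
    have a2 := adj_right_of_mul_ne_zero hu h2 ⟨rfl, rfl, Sym2.mem_mk_right _ _⟩
    have ht := decoloredTag_eq hu hG hG' hx
    have hcol := decoloredColor_eq hu hG hG' hn hm hx
    rcases x' with ⟨w, j⟩ | ⟨f, j⟩
    · simp [x, decoloredTag] at ht
    rw [decolor_adj_inl_inr] at a1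
    rw [decolor_adj_inr_inl] at a2
    have hne : v' ≠ z' := fun e => hvz.ne
      (congrArg Sigma.fst (Sum.inl.inj ((hu.compat h).1.2 (by rw [e]))))
    have hf : f.val = s(v', z') := (Sym2.mem_and_mem_iff hne).1 ⟨a1.2.2, a2.2.2⟩
    have hcol : G.edgeColor s(v, z) = G'.edgeColor f := Sum.inr.inj hcol
    exact ⟨by simpa [hf] using f.2.1, by rw [hcol, hf]⟩

/-- A quantum isomorphism of decolored graphs restricts to a quantum isomorphism of the colored
graphs. -/
theorem IsQuantumIso.isColoredQuantumIso :
    IsColoredQuantumIso G G' fun v v' => u (decoloredRoot v) (decoloredRoot v') where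
  row_sum v := by simpa using sum_decoloredRoot hu hG hG' 1 1 v
  col_sum v' := by simpa using sum_decoloredRoot hu.symm hG' hG 1 1 v'
  vertexColor_eq h := Sum.inl.inj (decoloredColor_eq hu hG hG' hn hm h)
  compat {v z v' z'} h := by
    refine ⟨?_, ⟨fun a => (decolored_edge_compat hu hG hG' hn hm h a).1,
      fun a => (decolored_edge_compat hu.symm hG' hG hn hm h a).1⟩,
      fun a => (decolored_edge_compat hu hG hG' hn hm h a).2⟩
    exact decoloredRoot_inj.symm.trans ((hu.compat h).1.trans decoloredRoot_inj)

omit hn hm in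
/-- If the entries at the vertices of the colored graph commute, then all entries commute. -/
theorem decolored_commute
    (hw : ∀ v v' z z', Commute (u (decoloredRoot v) (decoloredRoot v'))
      (u (decoloredRoot z) (decoloredRoot z'))) (x x' y y') : Commute (u x x') (u y y') := by
  have path : ∀ v v' (i : ℕ) (hi hi'), u (.inl ⟨v, ⟨i, hi⟩⟩) (.inl ⟨v', ⟨i, hi'⟩⟩) =
      u (decoloredRoot v) (decoloredRoot v') := by
    intro v v' i
    induction i with
    | zero => exact fun _ _ => rfl
    | succ i ih =>
      intro hi hi'
      rw [← ih (by omega) (by omega)]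
      refine hu.entry_eq (fun z h => ?_) fun z h => ?_
      · have a := adj_right_of_mul_ne_zero hu h (.inl ⟨rfl, .inr rfl⟩)
        have ht := decoloredTag_eq hu hG hG' (right_ne_zero_of_mul h)
        rcases z with ⟨w, j⟩ | ⟨f, j⟩
        · simp [decoloredTag, decolor_adj_inl_inl] at a ht
          exact decolored_inl_ext a.1.symm ht.symm
        · simp [decoloredTag] at ht
      · have a := adj_right_of_mul_ne_zero hu h (.inl ⟨rfl, .inr rfl⟩)
        have ht := decoloredTag_eq hu hG hG' (left_ne_zero_of_mul h)
        rcases z with ⟨w, j⟩ | ⟨f, j⟩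
        · simp [decoloredTag, decolor_adj_inl_inl] at a ht
          exact decolored_inl_ext (a.resolve_right fun h => by simp [h.1] at ht).1 ht.symm
        · simp [decoloredTag] at ht
  have epath : ∀ e e' (i : ℕ) (hi hi'), u (.inr ⟨e, ⟨i, hi⟩⟩) (.inr ⟨e', ⟨i, hi'⟩⟩) =
      u (.inr ⟨e, 0⟩) (.inr ⟨e', 0⟩) := by
    intro e e' i
    induction i with
    | zero => exact fun _ _ => rfl
    | succ i ih =>
      intro hi hi'
      rw [← ih (by omega) (by omega)]
      refine hu.entry_eq (fun z h => ?_) fun z h => ?_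
      · have a := adj_right_of_mul_ne_zero hu h ⟨rfl, .inr rfl⟩
        have ht := decoloredTag_eq hu hG hG' (right_ne_zero_of_mul h)
        rcases z with ⟨w, j⟩ | ⟨f, j⟩
        · simp [decoloredTag] at ht
        · exact decolored_inr_ext a.1.symm (congrArg Prod.snd ht).symm
      · have a := adj_right_of_mul_ne_zero hu h ⟨rfl, .inr rfl⟩
        have ht := decoloredTag_eq hu hG hG' (left_ne_zero_of_mul h)
        rcases z with ⟨w, j⟩ | ⟨f, j⟩
        · simp [decoloredTag] at ht
        · exact decolored_inr_ext a.1 (congrArg Prod.snd ht).symm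
  -- Both sides equal the triple product of the entries (e, e'), (v, v'), (w, w'): given v ↦ v', the
  -- assignments e ↦ e' and w ↦ w' force each other. Commutation via `hw` brings the factors for e
  -- and w next to each other.
  have half : ∀ v w (h : s(v, w) ∈ G.graph.edgeSet ∧ G.edgeColor s(v, w) ≠ c₀) v' w' e',
      e'.val = s(v', w') → u (.inr ⟨⟨s(v, w), h⟩, 0⟩) (.inr ⟨e', 0⟩) *
        u (decoloredRoot v) (decoloredRoot v') =
        u (decoloredRoot v) (decoloredRoot v') * u (decoloredRoot w) (decoloredRoot w') := by
    intro v w h v' w' e' he'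
    have hne : v' ≠ w' := G'.graph.ne_of_adj (he' ▸ e'.2.1 : s(v', w') ∈ G'.graph.edgeSet)
    have h1 : u (.inr ⟨⟨s(v, w), h⟩, 0⟩) (.inr ⟨e', 0⟩) *
        u (decoloredRoot v) (decoloredRoot v') = u (.inr ⟨⟨s(v, w), h⟩, 0⟩) (.inr ⟨e', 0⟩) *
        (u (decoloredRoot v) (decoloredRoot v') * u (decoloredRoot w) (decoloredRoot w')) := by
      rw [← mul_one (_ * u (decoloredRoot v) (decoloredRoot v')),
        ← sum_decoloredRoot hu hG hG' _ 1 w, Fintype.sum_eq_single w', mul_one, mul_assoc]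
      intro b hb
      rw [mul_one]
      by_contra h0
      have hbv : v' ≠ b := fun hbv => h.1.ne (decoloredRoot_inj.1
        ((hu.compat (right_ne_zero_of_mul (mul_assoc (u _ _) _ (u _ _) ▸ h0))).1.2
          (congrArg _ hbv)))
      rw [mul_assoc, (hw _ _ _ _).eq, ← mul_assoc] at h0
      have a := (adj_right_of_mul_ne_zero hu (left_ne_zero_of_mul h0)
        ⟨rfl, rfl, Sym2.mem_mk_right _ _⟩).2.2
      rw [he', Sym2.mem_iff] at a
      exact a.elim (fun a => hbv a.symm) hb
    rw [h1]
    conv_rhs => rw [← one_mul (_ * _), ← hu.row_sum (.inr ⟨⟨s(v, w), h⟩, 0⟩), Finset.sum_mul]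
    symm
    refine Fintype.sum_eq_single _ fun z hz => ?_
    by_contra h0
    have ht := decoloredTag_eq hu hG hG' (left_ne_zero_of_mul h0)
    rcases z with ⟨b, j⟩ | ⟨f, j⟩
    · simp [decoloredTag] at ht
    refine hz (decolored_inr_ext ?_ (congrArg Prod.snd ht).symm)
    have h0' := h0
    rw [← mul_assoc] at h0
    rw [(hw _ _ _ _).eq, ← mul_assoc] at h0'
    have a1 := (adj_right_of_mul_ne_zero hu (left_ne_zero_of_mul h0)
        ⟨rfl, rfl, Sym2.mem_mk_left _ _⟩).2.2
    have a2 := (adj_right_of_mul_ne_zero hu (left_ne_zero_of_mul h0')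
        ⟨rfl, rfl, Sym2.mem_mk_right _ _⟩).2.2
    exact Subtype.ext (((Sym2.mem_and_mem_iff hne).1 ⟨a1, a2⟩).trans he'.symm)
  have edge : ∀ v w (h : s(v, w) ∈ G.graph.edgeSet ∧ G.edgeColor s(v, w) ≠ c₀) v' w' e',
      e'.val = s(v', w') → u (.inr ⟨⟨s(v, w), h⟩, 0⟩) (.inr ⟨e', 0⟩) =
        u (decoloredRoot v) (decoloredRoot v') * u (decoloredRoot w) (decoloredRoot w') +
        u (decoloredRoot v) (decoloredRoot w') * u (decoloredRoot w) (decoloredRoot v') := by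
    intro v w h v' w' e' he'
    have hne : v' ≠ w' := G'.graph.ne_of_adj (he' ▸ e'.2.1 : s(v', w') ∈ G'.graph.edgeSet)
    rw [← half v w h v' w' e' he', ← half v w h w' v' e' (he'.trans Sym2.eq_swap)]
    -- Expand `1` along row `v`; only the two endpoints of `e'` contribute.
    conv_lhs => rw [← mul_one (u _ _), ← mul_one (_ * 1), mul_one (u _ _),
      ← sum_decoloredRoot hu hG hG' _ 1 v]
    simp only [mul_one]
    refine Fintype.sum_eq_add _ _ hne fun b hb => ?_
    by_contra h0
    have a := (adj_right_of_mul_ne_zero hu h0 ⟨rfl, rfl, Sym2.mem_mk_left _ _⟩).2.2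
    rw [he', Sym2.mem_iff] at a
    tauto
  -- Every entry is zero, a root entry, or a sum of products of root entries. Applying this to each
  -- of the two factors in turn gives the claim.
  have key : ∀ a, (∀ v v', Commute (u (decoloredRoot v) (decoloredRoot v')) a) →
      ∀ x x', Commute (u x x') a := by
    intro a ha x x'
    by_cases h : u x x' = 0
    · rw [h]
      exact Commute.zero_left a
    have ht := decoloredTag_eq hu hG hG' h
    rcases x with ⟨v, i⟩ | ⟨e, i⟩ <;> rcases x' with ⟨v', j, hj⟩ | ⟨e', j, hj⟩
    · obtain rfl : i.val = j := congrArg Prod.snd ht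
      rw [path v v' i.val i.2 hj]
      exact ha v v'
    · simp [decoloredTag] at ht
    · simp [decoloredTag] at ht
    · obtain rfl : i.val = j := congrArg Prod.snd ht
      rw [epath e e' i.val i.2 hj]
      obtain ⟨⟨v, w⟩, he⟩ := e
      obtain ⟨⟨v', w'⟩, he'⟩ := e'
      rw [edge v w he v' w' ⟨_, he'⟩ rfl]
      exact ((ha _ _).mul_left (ha _ _)).add_left ((ha _ _).mul_left (ha _ _))
  exact key _ (fun v v' => (key _ (fun z z' => hw z z' v v') y y').symm) x x'

end QuantumIso

/-! ### Signs, colors and adjacency in the graph of a linear system -/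

section SystemGraph

variable {K E : Type*} [Fintype E] [DecidableEq E] {M : Matrix K E (ZMod 2)} {b b' : K → ZMod 2}

/-- The sign that a vertex of the system graph assigns to a variable, extended by `1`. -/
def systemSign (v : SystemVertex M b) (e : E) : ℤˣ :=
  if h : e ∈ eqnSupport M v.1 then v.2.1 ⟨e, h⟩ else 1

theorem systemSign_coe (v : SystemVertex M b) (e : eqnSupport M v.1) :
    systemSign v e = v.2.1 e := by
  rw [systemSign, dif_pos e.2]

theorem prod_systemSign (v : SystemVertex M b) :
    ∏ e ∈ eqnSupport M v.1, systemSign v e = (-1) ^ (b v.1).val := by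
  rw [← Finset.prod_coe_sort, ← v.2.2]
  exact Finset.prod_congr rfl fun e _ => systemSign_coe v e

theorem systemVertex_ext {v z : SystemVertex M b} (h : v.1 = z.1)
    (hs : ∀ e ∈ eqnSupport M v.1, systemSign v e = systemSign z e) : v = z := by
  obtain ⟨k, α⟩ := v
  obtain ⟨l, β⟩ := z
  obtain rfl : k = l := h
  refine congrArg (Sigma.mk k) (Subtype.ext (funext fun e => ?_))
  have := hs e e.2
  rwa [systemSign_coe ⟨k, α⟩ e, systemSign_coe ⟨k, β⟩ e] at this

/-- The vertex of the system graph given by the restriction of a sign function. -/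
def mkSystemVertex (k : K) (c : E → ℤˣ) (h : ∏ e ∈ eqnSupport M k, c e = (-1) ^ (b k).val) :
    SystemVertex M b :=
  ⟨k, fun e => c e, by
    rw [← h]
    exact Finset.prod_coe_sort (eqnSupport M k) c⟩

theorem systemSign_mkSystemVertex {k : K} {c : E → ℤˣ}
    (h : ∏ e ∈ eqnSupport M k, c e = (-1) ^ (b k).val) {e : E} (he : e ∈ eqnSupport M k) :
    systemSign (mkSystemVertex k c h) e = c e :=
  systemSign_coe (mkSystemVertex k c h) ⟨e, he⟩

theorem signProd_apply (v z : SystemVertex M b) (e : E)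
    (h : e ∈ eqnSupport M v.1 ∩ eqnSupport M z.1) :
    (signProd v z).2 ⟨e, h⟩ = systemSign v e * systemSign z e := by
  rw [systemSign, systemSign, dif_pos (Finset.mem_inter.1 h).1, dif_pos (Finset.mem_inter.1 h).2]
  rfl

theorem total_signProd {v z : SystemVertex M b} {e : E}
    (h : eqnSupport M v.1 ∩ eqnSupport M z.1 = {e}) :
    (signProd v z).total = systemSign v e * systemSign z e := by
  have he : e ∈ eqnSupport M v.1 ∩ eqnSupport M z.1 := by simp [h]
  rw [SignFunction.total, ← signProd_apply v z e he]
  refine Fintype.prod_eq_single _ fun i hi => absurd (Subtype.ext ?_) hi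
  have hi : i.val ∈ eqnSupport M v.1 ∩ eqnSupport M z.1 := i.2
  rw [h] at hi
  exact Finset.mem_singleton.1 hi

theorem starColor_of_eq {v z : SystemVertex M b} (h : v.1 = z.1) :
    starColor M b s(v, z) = .inr (signProd v z) := by
  simp [starColor, h]

theorem starColor_of_ne {v z : SystemVertex M b} (h : v.1 ≠ z.1) :
    starColor M b s(v, z) = .inl (signProd v z).total := by
  simp [starColor, h]

theorem starGraph_adj {v z : SystemVertex M b} : (starGraph M b).graph.Adj v z ↔
    (v ≠ z ∧ (eqnSupport M v.1 ∩ eqnSupport M z.1).Nonempty) ∧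
      starColor M b s(v, z) ≠ .inl 1 := Iff.rfl

theorem starGraph_edgeColor (e : Sym2 (SystemVertex M b)) :
    (starGraph M b).edgeColor e = starColor M b e := rfl

theorem starGraph_adj_of_ne {v z : SystemVertex M b} {e : E} (hvz : v.1 ≠ z.1)
    (h : eqnSupport M v.1 ∩ eqnSupport M z.1 = {e}) :
    (starGraph M b).graph.Adj v z ↔ systemSign v e * systemSign z e = -1 := by
  rw [starGraph_adj, starColor_of_ne hvz, total_signProd h, h]
  have hne : v ≠ z := fun h => hvz (congrArg _ h)
  rcases Int.units_eq_one_or (systemSign v e * systemSign z e) with h | h <;> simp [h, hne]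

/-- Within one equation the edge color is the product of the two assignments. Between two equations
the only common variable is `e` by `hM`, and adjacency holds exactly if the product there is -1. -/
theorem sign_mul_eq_of_compat
    (hM : ∀ k l, k ≠ l → ∀ e ∈ eqnSupport M k, e ∈ eqnSupport M l →
      eqnSupport M k ∩ eqnSupport M l = {e})
    {v z : SystemVertex M b} {v' z' : SystemVertex M b'} (hv : v.1 = v'.1) (hz : z.1 = z'.1)
    (h1 : v = z ↔ v' = z')
    (h2 : (starGraph M b).graph.Adj v z ↔ (starGraph M b').graph.Adj v' z')
    (h3 : (starGraph M b).graph.Adj v z →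
      (starGraph M b).edgeColor s(v, z) = (starGraph M b').edgeColor s(v', z'))
    {e : E} (hev : e ∈ eqnSupport M v.1) (hez : e ∈ eqnSupport M z.1) :
    systemSign v e * systemSign z e = systemSign v' e * systemSign z' e := by
  by_cases h : v.1 = z.1
  · by_cases hvz : v = z
    · rw [← h1.1 hvz, ← hvz, Int.units_mul_self, Int.units_mul_self]
    · have hadj : (starGraph M b).graph.Adj v z :=
        ⟨⟨hvz, e, Finset.mem_inter.2 ⟨hev, hez⟩⟩, by rw [starColor_of_eq h]; simp⟩
      have hc := h3 hadj
      rw [starGraph_edgeColor, starGraph_edgeColor, starColor_of_eq h,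
        starColor_of_eq (hv.symm.trans (h.trans hz))] at hc
      have key : ∀ {p q : SignFunction E}, p = q → ∀ hp hq, p.2 ⟨e, hp⟩ = q.2 ⟨e, hq⟩ := by
        rintro p _ rfl _ _
        rfl
      rw [← signProd_apply v z e (Finset.mem_inter.2 ⟨hev, hez⟩),
        ← signProd_apply v' z' e (Finset.mem_inter.2 ⟨hv ▸ hev, hz ▸ hez⟩)]
      exact key (Sum.inr.inj hc) _ _
  · rw [starGraph_adj_of_ne h (hM _ _ h e hev hez), starGraph_adj_of_ne (hv ▸ hz ▸ h)
      (hM _ _ (hv ▸ hz ▸ h) e (hv ▸ hev) (hz ▸ hez))] at h2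
    rcases Int.units_eq_one_or (systemSign v e * systemSign z e) with h | h <;>
      rcases Int.units_eq_one_or (systemSign v' e * systemSign z' e) with h' | h' <;>
      simp [h, h'] at h2 ⊢

end SystemGraph

theorem IsColoredQuantumIso.isQuantumIso {V V' K C : Type*} [Fintype V] [Fintype V']
    {G : ColoredGraph V K C} {G' : ColoredGraph V' K C} {A : Type*} [Ring A] {w : V → V' → A}
    (hw : IsColoredQuantumIso G G' w) : IsQuantumIso G.graph G'.graph w where
  row_sum := hw.row_sum
  col_sum := hw.col_sum
  compat h := ⟨(hw.compat h).1, (hw.compat h).2.1⟩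

/-- A row of a magic unitary as an algebra homomorphism. -/
def IsQuantumIso.rowHom {V V' : Type*} [Fintype V] [Fintype V'] {G : SimpleGraph V}
    {G' : SimpleGraph V'} {A : Type*} [Ring A] [Algebra ℂ A] {u : V → V' → A}
    (hu : IsQuantumIso G G' u) (x : V) : (V' → ℂ) →+* A where
  toFun f := ∑ x', f x' • u x x'
  map_one' := by simp [hu.row_sum]
  map_zero' := by simp
  map_add' f g := by simp [add_smul, Finset.sum_add_distrib]
  map_mul' f g := by
    rw [Finset.sum_mul_sum]
    refine Finset.sum_congr rfl fun x' _ => ?_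
    rw [Fintype.sum_eq_single x', smul_mul_smul_comm, hu.mul_self, Pi.mul_apply]
    intro y' hy'
    rw [smul_mul_smul_comm]
    by_contra h
    exact hy' ((hu.compat (right_ne_zero_of_smul h)).1.1 rfl).symm

/-! ### Observables attached to the variables -/

section Observables

variable {K E : Type*} [Fintype E] [DecidableEq E] {M : Matrix K E (ZMod 2)}
  {b b' : K → ZMod 2} {A : Type*} [Ring A] [Algebra ℂ A]

/-- The relative sign of two vertices at a variable. -/
def relSign (v : SystemVertex M b) (e : E) (v' : SystemVertex M b') : ℂ :=
  ((systemSign v e * systemSign v' e : ℤˣ) : ℤ)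

theorem relSign_mul_self (v : SystemVertex M b) (e : E) :
    relSign v e * relSign v e = (1 : SystemVertex M b' → ℂ) := by
  funext v'
  rw [Pi.mul_apply, relSign, ← Int.cast_mul, ← Units.val_mul, Int.units_mul_self]
  simp

theorem prod_relSign {v : SystemVertex M b} {v' : SystemVertex M b'} (h : v'.1 = v.1) :
    (∏ e ∈ eqnSupport M v.1, relSign v e) v' =
      ((((-1) ^ (b v.1).val * (-1) ^ (b' v.1).val : ℤˣ) : ℤ) : ℂ) := by
  have h' := prod_systemSign v'
  rw [h] at h'
  rw [Finset.prod_apply, ← prod_systemSign v, ← h', ← Finset.prod_mul_distrib]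
  simp [relSign]

variable [Fintype K] {w : SystemVertex M b → SystemVertex M b' → A}
  (hw : IsColoredQuantumIso (starGraph M b) (starGraph M b') w)
include hw

theorem rowHom_congr {v : SystemVertex M b} {f g : SystemVertex M b' → ℂ}
    (h : ∀ v', v'.1 = v.1 → f v' = g v') :
    hw.isQuantumIso.rowHom v f = hw.isQuantumIso.rowHom v g := by
  refine Finset.sum_congr rfl fun v' _ => ?_
  by_cases h0 : w v v' = 0
  · simp [h0]
  · rw [h v' (hw.vertexColor_eq h0).symm]

/-- The observable of a variable does not depend on the equation that is used to define it. -/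
theorem rowHom_relSign_eq
    (hM : ∀ k l, k ≠ l → ∀ e ∈ eqnSupport M k, e ∈ eqnSupport M l →
      eqnSupport M k ∩ eqnSupport M l = {e})
    {v z : SystemVertex M b} {e : E} (hev : e ∈ eqnSupport M v.1) (hez : e ∈ eqnSupport M z.1) :
    hw.isQuantumIso.rowHom v (relSign v e) = hw.isQuantumIso.rowHom z (relSign z e) := by
  -- Expand both observables over the products `w v v' * w z z'`. Wherever such a product is
  -- nonzero, the two relative signs coincide.
  have h1 : hw.isQuantumIso.rowHom v (relSign v e) =
      ∑ v', ∑ z', relSign v e v' • (w v v' * w z z') := by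
    refine Finset.sum_congr rfl fun v' _ => ?_
    rw [← Finset.smul_sum, ← Finset.mul_sum, hw.row_sum, mul_one]
  have h2 : hw.isQuantumIso.rowHom z (relSign z e) =
      ∑ v', ∑ z', relSign z e z' • (w v v' * w z z') := by
    rw [Finset.sum_comm]
    refine Finset.sum_congr rfl fun v' _ => ?_
    rw [← Finset.smul_sum, ← Finset.sum_mul, hw.row_sum, one_mul]
  rw [h1, h2]
  refine Finset.sum_congr rfl fun v' _ => Finset.sum_congr rfl fun z' _ => ?_
  by_cases h0 : w v v' * w z z' = 0
  · simp [h0]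
  obtain ⟨c1, c2, c3⟩ := hw.compat h0
  have := sign_mul_eq_of_compat hM (hw.vertexColor_eq (left_ne_zero_of_mul h0))
    (hw.vertexColor_eq (right_ne_zero_of_mul h0)) c1 c2 c3 hev hez
  have e : systemSign v e * systemSign v' e = systemSign z e * systemSign z' e := by
    calc _ = systemSign v e * systemSign z e * systemSign z e * systemSign v' e := by
          rw [mul_assoc (systemSign v e), Int.units_mul_self, mul_one]
      _ = (systemSign v' e * systemSign v' e) * (systemSign z e * systemSign z' e) := by
          rw [this]
          ac_rfl
      _ = _ := by rw [Int.units_mul_self, one_mul]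
  rw [relSign, relSign, e]

/-- The indicator function of `v'` is a polynomial in the relative signs, so its image `w v v'`
under `rowHom` is a polynomial in the observables. -/
theorem entry_commute_of_relSign {v : SystemVertex M b} (v' : SystemVertex M b') {a : A}
    (h : ∀ e ∈ eqnSupport M v.1, Commute (hw.isQuantumIso.rowHom v (relSign v e)) a) :
    Commute (w v v') a := by
  classical
  by_cases h0 : w v v' = 0
  · rw [h0]
    exact Commute.zero_left a
  have hv := hw.vertexColor_eq h0
  -- At z' the factor for e is (1 + v'_e z'_e)/2, because the signs of `v` cancel: it is 1 if z' and
  -- v' agree at e and 0 otherwise.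
  have e1 : w v v' = hw.isQuantumIso.rowHom v (∏ e ∈ eqnSupport M v.1,
      ((1 / 2 : ℂ) • 1 + (relSign v e v' / 2) • relSign v e)) := by
    have : w v v' = hw.isQuantumIso.rowHom v (Pi.single v' 1) := by
      change _ = ∑ z', (Pi.single v' 1 : SystemVertex M b' → ℂ) z' • w v z'
      rw [Fintype.sum_eq_single v' fun z hz => by simp [hz]]
      simp
    rw [this]
    refine rowHom_congr hw fun z' hz' => ?_
    rw [Finset.prod_apply]
    by_cases hzv : z' = v'
    · subst hzv
      rw [Pi.single_eq_same]
      refine (Finset.prod_eq_one fun e _ => ?_).symm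
      have := congrFun (relSign_mul_self (b' := b') v e) z'
      simp only [Pi.mul_apply, Pi.one_apply] at this
      simp only [Pi.add_apply, Pi.smul_apply, Pi.one_apply, smul_eq_mul]
      linear_combination this / 2
    · rw [Pi.single_eq_of_ne hzv]
      have : ∃ e ∈ eqnSupport M v.1, systemSign z' e ≠ systemSign v' e := by
        by_contra! hc
        exact hzv (systemVertex_ext (hz'.trans hv) (hz' ▸ hc))
      obtain ⟨e, he, hne⟩ := this
      refine (Finset.prod_eq_zero he ?_).symm
      simp only [Pi.add_apply, Pi.smul_apply, Pi.one_apply, smul_eq_mul, relSign]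
      rcases Int.units_eq_one_or (systemSign z' e) with h | h <;>
        rcases Int.units_eq_one_or (systemSign v' e) with h' | h' <;>
        rcases Int.units_eq_one_or (systemSign v e) with h'' | h'' <;>
        simp [h, h', h''] at hne ⊢ <;> norm_num
  have hs : ∀ (c : ℂ) f, hw.isQuantumIso.rowHom v (c • f) = c • hw.isQuantumIso.rowHom v f := by
    intro c f
    change ∑ _, _ = c • ∑ _, _
    simp [Finset.smul_sum, mul_smul]
  rw [e1]
  refine Finset.prod_induction _ (fun f => Commute (hw.isQuantumIso.rowHom v f) a) ?_ ?_ ?_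
  · intro f g hf hg
    rw [map_mul]
    exact hf.mul_left hg
  · rw [map_one]
    exact Commute.one_left a
  · intro e he
    rw [map_add, hs, hs, map_one]
    exact ((Commute.one_left a).smul_left _).add_left ((h e he).smul_left _)

end Observables

/-! ### The incidence system of K_{3,3} -/

section K33

theorem mem_eqnSupport_graphIncidence {K : Type*} (H : SimpleGraph K) [Fintype H.edgeSet]
    [DecidableEq H.edgeSet] (k : K) (e : H.edgeSet) :
    e ∈ eqnSupport (graphIncidence H) k ↔ k ∈ e.val := by
  classical
  have h : graphIncidence H k e = H.incMatrix (ZMod 2) k e.val := by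
    simp only [graphIncidence, Matrix.submatrix_apply, id]
  have h' : e.val ∈ H.incidenceSet k ↔ k ∈ e.val := and_iff_right e.2
  rw [eqnSupport, Finset.mem_filter, h, SimpleGraph.incMatrix_apply', ← h']
  simp

theorem eqnSupport_graphIncidence_inter {K : Type*} (H : SimpleGraph K) [Fintype H.edgeSet]
    [DecidableEq H.edgeSet] (k l : K) (hkl : k ≠ l) (e : H.edgeSet)
    (hk : e ∈ eqnSupport (graphIncidence H) k) (hl : e ∈ eqnSupport (graphIncidence H) l) :
    eqnSupport (graphIncidence H) k ∩ eqnSupport (graphIncidence H) l = {e} := by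
  ext f
  rw [Finset.mem_inter, Finset.mem_singleton]
  refine ⟨fun h => ?_, fun h => h ▸ ⟨hk, hl⟩⟩
  rw [mem_eqnSupport_graphIncidence] at hk hl
  rw [mem_eqnSupport_graphIncidence, mem_eqnSupport_graphIncidence] at h
  exact Subtype.ext (((Sym2.mem_and_mem_iff hkl).1 h).trans ((Sym2.mem_and_mem_iff hkl).1 ⟨hk, hl⟩).symm)

/-- The neighbors of a vertex of `K_{3,3}`. -/
def k33Nbr : Fin 3 ⊕ Fin 3 → Fin 3 → Fin 3 ⊕ Fin 3
  | .inl _, j => .inr j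
  | .inr _, j => .inl j

theorem k33Nbr_ne (k j) : k33Nbr k j ≠ k := by
  cases k <;> simp [k33Nbr]

theorem k33Nbr_injective (k) : Function.Injective (k33Nbr k) := by
  cases k
  · exact Sum.inr_injective
  · exact Sum.inl_injective

/-- The edges of `K_{3,3}` at a given vertex. -/
def k33Edge (k : Fin 3 ⊕ Fin 3) (j : Fin 3) : (completeBipartiteGraph (Fin 3) (Fin 3)).edgeSet :=
  ⟨s(k, k33Nbr k j), by cases k <;> simp [k33Nbr]⟩

theorem k33Edge_inl_inr (i j : Fin 3) : k33Edge (.inl i) j = k33Edge (.inr j) i :=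
  Subtype.ext Sym2.eq_swap

theorem k33Edge_injective (k : Fin 3 ⊕ Fin 3) : Function.Injective (k33Edge k) := by
  intro i j h
  have := congrArg Subtype.val h
  simp only [k33Edge, Sym2.congr_right] at this
  exact k33Nbr_injective k this

theorem eqnSupport_incidenceK33 (k : Fin 3 ⊕ Fin 3) :
    eqnSupport incidenceK33 k = Finset.univ.image (k33Edge k) := by
  ext ⟨e, he⟩
  rw [mem_eqnSupport_graphIncidence, Finset.mem_image]
  constructor
  · intro hk
    obtain ⟨l, rfl⟩ := Sym2.mem_iff_exists.1 hk
    obtain ⟨j, rfl⟩ : ∃ j, k33Nbr k j = l := by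
      cases k <;> cases l <;> simp [k33Nbr] at he ⊢
    exact ⟨j, Finset.mem_univ _, rfl⟩
  · rintro ⟨j, -, h⟩
    have : s(k, k33Nbr k j) = e := congrArg Subtype.val h
    change k ∈ e
    rw [← this]
    exact Sym2.mem_mk_left _ _

theorem k33Edge_mem (k : Fin 3 ⊕ Fin 3) (j : Fin 3) :
    k33Edge k j ∈ eqnSupport incidenceK33 k := by
  rw [eqnSupport_incidenceK33]
  exact Finset.mem_image_of_mem _ (Finset.mem_univ _)

theorem k33Edge_mem_nbr (k : Fin 3 ⊕ Fin 3) (j : Fin 3) :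
    k33Edge k j ∈ eqnSupport incidenceK33 (k33Nbr k j) := by
  rw [mem_eqnSupport_graphIncidence]
  exact Sym2.mem_mk_right _ _

theorem prod_eqnSupport_incidenceK33 {α : Type*} [CommMonoid α] (k : Fin 3 ⊕ Fin 3)
    (f : (completeBipartiteGraph (Fin 3) (Fin 3)).edgeSet → α) :
    ∏ e ∈ eqnSupport incidenceK33 k, f e = ∏ j, f (k33Edge k j) := by
  rw [eqnSupport_incidenceK33, Finset.prod_image (k33Edge_injective k).injOn]

variable {b b' : Fin 3 ⊕ Fin 3 → ZMod 2}

/-- Every sign of a variable is part of two solutions of any equation it occurs in. -/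
theorem exists_two_systemVertex (b : Fin 3 ⊕ Fin 3 → ZMod 2) (k : Fin 3 ⊕ Fin 3)
    {e : (completeBipartiteGraph (Fin 3) (Fin 3)).edgeSet} (he : e ∈ eqnSupport incidenceK33 k)
    (a : ℤˣ) : ∃ v z : SystemVertex incidenceK33 b, v.1 = k ∧ z.1 = k ∧
      systemSign v e = a ∧ systemSign z e = a ∧ v ≠ z := by
  have hc : ((eqnSupport incidenceK33 k).erase e).card = 2 := by
    rw [Finset.card_erase_of_mem he, eqnSupport_incidenceK33,
      Finset.card_image_of_injective _ (k33Edge_injective k)]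
    simp
  obtain ⟨f, g, hfg, h⟩ := Finset.card_eq_two.1 hc
  have hf : f ∈ (eqnSupport incidenceK33 k).erase e := by simp [h]
  have hg : g ∈ (eqnSupport incidenceK33 k).erase e := by simp [h]
  rw [Finset.mem_erase] at hf hg
  -- The sign at `e` is prescribed, the one at `f` is free, and the one at the third edge `g` is
  -- forced by the equation.
  let c : ℤˣ → (completeBipartiteGraph (Fin 3) (Fin 3)).edgeSet → ℤˣ := fun s i =>
    if i = e then a else if i = f then s else a * s * (-1) ^ (b k).val
  have hprod : ∀ s, ∏ i ∈ eqnSupport incidenceK33 k, c s i = (-1) ^ (b k).val := by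
    intro s
    rw [← Finset.mul_prod_erase _ _ he, h, Finset.prod_pair hfg]
    simp only [c, if_true, if_neg hf.1, if_neg hg.1, if_neg hfg.symm]
    calc _ = (a * a) * (s * s) * (-1) ^ (b k).val := by ac_rfl
      _ = _ := by simp [Int.units_mul_self]
  refine ⟨mkSystemVertex k (c 1) (hprod 1), mkSystemVertex k (c (-1)) (hprod (-1)), rfl, rfl,
    ?_, ?_, fun hvz => ?_⟩
  · rw [systemSign_mkSystemVertex _ he]
    simp [c]
  · rw [systemSign_mkSystemVertex _ he]
    simp [c]
  · have := congrArg (fun v => systemSign v f) hvz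
    simp only [systemSign_mkSystemVertex _ hf.2, c, if_neg hf.1, if_true] at this
    exact absurd this (by decide)

theorem exists_systemVertex (b : Fin 3 ⊕ Fin 3 → ZMod 2) (k : Fin 3 ⊕ Fin 3) :
    ∃ v : SystemVertex incidenceK33 b, v.1 = k := by
  obtain ⟨v, -, h, -⟩ := exists_two_systemVertex b k (k33Edge_mem k 0) 1
  exact ⟨v, h⟩

/-- Each of two neighboring equations has two solutions with the opposite sign at the shared
variable. They give four edges of color -1, which are not subdivided. -/
theorem fourLeDegree_starGraph (b : Fin 3 ⊕ Fin 3 → ZMod 2) (n : Fin 3 ⊕ Fin 3 → ℕ)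
    (m : StarColor (completeBipartiteGraph (Fin 3) (Fin 3)).edgeSet → ℕ) :
    FourLeDegree (starGraph incidenceK33 b) (Sum.inl (-1)) n m := by
  intro v
  have key : ∀ j, ∃ x y : SystemVertex incidenceK33 b, x.1 = k33Nbr v.1 j ∧ y.1 = k33Nbr v.1 j ∧
      x ≠ y ∧ ((starGraph incidenceK33 b).decolor (Sum.inl (-1)) n m).Adj (decoloredRoot v)
        (decoloredRoot x) ∧ ((starGraph incidenceK33 b).decolor (Sum.inl (-1)) n m).Adj
        (decoloredRoot v) (decoloredRoot y) := by
    intro j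
    obtain ⟨x, y, hx, hy, hxs, hys, hxy⟩ := exists_two_systemVertex b (k33Nbr v.1 j)
      (k33Edge_mem_nbr v.1 j) (-systemSign v (k33Edge v.1 j))
    have : ∀ x : SystemVertex incidenceK33 b, x.1 = k33Nbr v.1 j →
        systemSign x (k33Edge v.1 j) = -systemSign v (k33Edge v.1 j) →
        ((starGraph incidenceK33 b).decolor (Sum.inl (-1)) n m).Adj (decoloredRoot v)
        (decoloredRoot x) := by
      intro x hx hs
      have hne : v.1 ≠ x.1 := hx ▸ (k33Nbr_ne v.1 j).symm
      have hi := eqnSupport_graphIncidence_inter _ v.1 x.1 hne _ (k33Edge_mem v.1 j)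
        (hx ▸ k33Edge_mem_nbr v.1 j)
      have hm : systemSign v (k33Edge v.1 j) * systemSign x (k33Edge v.1 j) = -1 := by
        rw [hs, mul_neg, Int.units_mul_self]
      rw [decolor_adj_root, starGraph_adj_of_ne hne hi, starGraph_edgeColor, starColor_of_ne hne,
        total_signProd hi]
      exact ⟨hm, congrArg _ hm⟩
    exact ⟨x, y, hx, hy, hxy, this x hx hxs, this y hy hys⟩
  obtain ⟨x, y, hx, hy, hxy, ax, ay⟩ := key 0
  obtain ⟨x', y', hx', hy', hxy', ax', ay'⟩ := key 1
  have hne : k33Nbr v.1 0 ≠ k33Nbr v.1 1 := (k33Nbr_injective v.1).ne (by decide)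
  have n1 : x ≠ x' := fun h => hne (hx ▸ hx' ▸ congrArg _ h)
  have n2 : x ≠ y' := fun h => hne (hx ▸ hy' ▸ congrArg _ h)
  have n3 : y ≠ x' := fun h => hne (hy ▸ hx' ▸ congrArg _ h)
  have n4 : y ≠ y' := fun h => hne (hy ▸ hy' ▸ congrArg _ h)
  classical
  have hcard : ({x, y, x', y'} : Finset (SystemVertex incidenceK33 b)).card = 4 := by
    rw [Finset.card_insert_of_notMem (by simp [*]), Finset.card_insert_of_notMem (by simp [*]),
      Finset.card_pair hxy']
  rw [← hcard, ← Set.ncard_coe_finset]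
  refine Set.ncard_le_ncard_of_injOn (fun v => decoloredRoot v) ?_
    (fun _ _ _ _ h => decoloredRoot_inj.1 h) (Set.toFinite _)
  intro z hz
  simp only [Finset.coe_insert, Finset.coe_singleton, Set.mem_insert_iff,
    Set.mem_singleton_iff] at hz
  rcases hz with rfl | rfl | rfl | rfl
  exacts [⟨ax, trivial⟩, ⟨ay, trivial⟩, ⟨ax', trivial⟩, ⟨ay', trivial⟩]

/-- The sign on the right hand side of an equation. -/
def eqnSign (b : Fin 3 ⊕ Fin 3 → ZMod 2) (k : Fin 3 ⊕ Fin 3) : ℤˣ := (-1) ^ (b k).val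

/-! ### Operator solutions and the homogeneous magic square -/

section Solution

variable {A : Type*} [Ring A] [Algebra ℂ A]
  {w : SystemVertex incidenceK33 b → SystemVertex incidenceK33 b' → A}

/-- A quantum isomorphism of the colored graphs of two systems yields an operator solution of the
difference of the two systems. -/
theorem exists_operator_solution
    (hw : IsColoredQuantumIso (starGraph incidenceK33 b) (starGraph incidenceK33 b') w) :
    ∃ X : Fin 3 ⊕ Fin 3 → Fin 3 → A, (∀ i j, X (.inl i) j = X (.inr j) i) ∧
      (∀ k i j, Commute (X k i) (X k j)) ∧ (∀ k i, X k i * X k i = 1) ∧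
      (∀ k j₁ j₂ j₃, j₁ ≠ j₂ → j₁ ≠ j₃ → j₂ ≠ j₃ → X k j₁ * X k j₂ * X k j₃ =
        ((((eqnSign b k * eqnSign b' k : ℤˣ) : ℤ)) : A)) ∧
      ∀ a, (∀ k j, Commute (X k j) a) → ∀ v v', Commute (w v v') a := by
  choose v hv using exists_systemVertex b
  refine ⟨fun k j => hw.isQuantumIso.rowHom (v k) (relSign (v k) (k33Edge k j)), ?_, ?_, ?_, ?_, ?_⟩
  · intro i j
    beta_reduce
    rw [k33Edge_inl_inr]
    refine rowHom_relSign_eq hw (eqnSupport_graphIncidence_inter _) ?_ ?_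
    · rw [hv, ← k33Edge_inl_inr]
      exact k33Edge_mem _ _
    · rw [hv]
      exact k33Edge_mem _ _
  · intro k i j
    exact (Commute.all _ _).map _
  · intro k i
    rw [← map_mul, relSign_mul_self, map_one]
  · intro k j₁ j₂ j₃ h1 h2 h3
    rw [← map_mul, ← map_mul]
    have hu : (Finset.univ : Finset (Fin 3)) = {j₁, j₂, j₃} := by
      revert h1 h2 h3
      revert j₁ j₂ j₃
      decide
    -- The product over the whole equation is constant on vertices of color `k`: it is the product
    -- of the two right-hand signs.
    have hp : relSign (b' := b') (v k) (k33Edge k j₁) * relSign (v k) (k33Edge k j₂) *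
        relSign (v k) (k33Edge k j₃) =
        ∏ e ∈ eqnSupport incidenceK33 (v k).1, relSign (v k) e := by
      rw [hv, prod_eqnSupport_incidenceK33, hu, Finset.prod_insert (by simp [h1, h2]),
        Finset.prod_pair h3, mul_assoc]
    rw [hp, ← map_intCast (hw.isQuantumIso.rowHom (v k))]
    refine rowHom_congr hw fun v' hv' => ?_
    rw [prod_relSign hv', hv]
    rfl
  · intro a ha z z'
    refine entry_commute_of_relSign hw z' fun e he => ?_
    have he' := he
    rw [eqnSupport_incidenceK33] at he'
    obtain ⟨j, -, rfl⟩ := Finset.mem_image.1 he'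
    rw [rowHom_relSign_eq hw (eqnSupport_graphIncidence_inter _) (v := z) (z := v z.1) he
      (by rw [hv]; exact he)]
    exact ha z.1 j

/-- The operators in a solution of the homogeneous magic square commute. -/
theorem magicSquare_commute {A : Type*} [Ring A] {X : Fin 3 ⊕ Fin 3 → Fin 3 → A}
    (h1 : ∀ i j, X (.inl i) j = X (.inr j) i) (h2 : ∀ k i j, Commute (X k i) (X k j))
    (h3 : ∀ k i, X k i * X k i = 1)
    (h4 : ∀ k j₁ j₂ j₃, j₁ ≠ j₂ → j₁ ≠ j₃ → j₂ ≠ j₃ → X k j₁ * X k j₂ * X k j₃ = 1)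
    (k l i j) : Commute (X k i) (X l j) := by
  have h5 : ∀ k j₁ j₂ j₃, j₁ ≠ j₂ → j₁ ≠ j₃ → j₂ ≠ j₃ → X k j₁ * X k j₂ = X k j₃ := by
    intro k j₁ j₂ j₃ h h' h''
    rw [← mul_one (_ * _), ← h3 k j₃, ← mul_assoc, h4 k j₁ j₂ j₃ h h' h'', one_mul]
  have third : ∀ i j : Fin 3, i ≠ j → ∃ l, i ≠ l ∧ j ≠ l := by decide
  have main : ∀ i i' j j', Commute (X (.inl i) j) (X (.inl i') j') := by
    intro i i' j j'
    by_cases hi : i = i'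
    · rw [hi]
      exact h2 _ _ _
    by_cases hj : j = j'
    · rw [hj, h1, h1]
      exact h2 _ _ _
    obtain ⟨i'', hi1, hi2⟩ := third i i' hi
    obtain ⟨j'', hj1, hj2⟩ := third j j' hj
    -- The entry at (i'', j'') is computed from the 2 × 2 block, rows first in `e1` and columns
    -- first in `e2`. Cancelling the common outer involutions leaves the commutation relation.
    have e1 : X (.inl i) j' * X (.inl i) j * (X (.inl i') j' * X (.inl i') j) =
        X (.inl i'') j'' := by
      rw [h5 _ j' j j'' (Ne.symm hj) hj2 hj1, h5 _ j' j j'' (Ne.symm hj) hj2 hj1, h1, h1, h1]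
      exact h5 _ i i' i'' hi hi1 hi2
    have e2 : X (.inl i) j' * X (.inl i') j' * (X (.inl i) j * X (.inl i') j) =
        X (.inl i'') j'' := by
      rw [h1 i j', h1 i' j', h1 i j, h1 i' j, h5 _ i i' i'' hi hi1 hi2, h5 _ i i' i'' hi hi1 hi2,
        ← h1, ← h1]
      exact h5 _ j' j j'' (Ne.symm hj) hj2 hj1
    have e3 := congrArg (fun a => X (.inl i) j' * a * X (.inl i') j) (e1.trans e2.symm)
    have c1 : ∀ a, X (.inl i) j' * (X (.inl i) j' * a) = a := fun a => by
      rw [← mul_assoc, h3, one_mul]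
    simp only [mul_assoc, c1, h3, mul_one] at e3
    exact e3
  rcases k with k | k <;> rcases l with l | l
  · exact main _ _ _ _
  · rw [← h1]
    exact main _ _ _ _
  · rw [← h1]
    exact main _ _ _ _
  · rw [← h1, ← h1]
    exact main _ _ _ _

end Solution

variable {n : Fin 3 ⊕ Fin 3 → ℕ} (hn : Function.Injective n)
  {m : StarColor (completeBipartiteGraph (Fin 3) (Fin 3)).edgeSet → ℕ}
  (hm : Set.InjOn m {c | c ≠ Sum.inl (-1)})
include hn hm

/-- With equal right-hand sides all signs of the operator solution are squares, hence 1, whatever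
`b` is. -/
theorem noQuantumSymmetry_starGraph (b : Fin 3 ⊕ Fin 3 → ZMod 2) :
    NoQuantumSymmetry ((starGraph incidenceK33 b).decolor (Sum.inl (-1)) n m) := by
  have hu := (CQut.isQuantumAutomorphism_u
    ((starGraph incidenceK33 b).decolor (Sum.inl (-1)) n m)).isQuantumIso
  have hG := fourLeDegree_starGraph b n m
  have hw := hu.isColoredQuantumIso hG hG hn hm
  obtain ⟨X, h1, h2, h3, h4, h5⟩ := exists_operator_solution hw
  have hX := magicSquare_commute h1 h2 h3 fun k j₁ j₂ j₃ a b c => by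
    rw [h4 k j₁ j₂ j₃ a b c, Int.units_mul_self]
    simp
  have hww := fun v v' z z' => h5 _ (fun k j => (h5 _ (fun l i => hX l k i j) z z').symm) v v'
  exact noQuantumSymmetry_of_commute (decolored_commute hu hG hG hww)

theorem isEmpty_iso_starGraph (hb : ∏ k, (eqnSign b k * eqnSign b' k) = -1) :
    IsEmpty ((starGraph incidenceK33 b).decolor (Sum.inl (-1)) n m ≃g
      (starGraph incidenceK33 b').decolor (Sum.inl (-1)) n m) := by
  refine ⟨fun φ => ?_⟩
  have hw := (IsQuantumIso.of_iso φ).isColoredQuantumIso (fourLeDegree_starGraph b n m)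
    (fourLeDegree_starGraph b' n m) hn hm
  obtain ⟨X, h1, -, -, h4, -⟩ := exists_operator_solution hw
  have h5 : ∀ k, ∏ j, X k j = ((eqnSign b k * eqnSign b' k : ℤˣ) : ℤ) := fun k => by
    rw [Fin.prod_univ_three]
    exact h4 k 0 1 2 (by decide) (by decide) (by decide)
  have h6 : (∏ k, ((eqnSign b k * eqnSign b' k : ℤˣ) : ℤ) : ℂ) = -1 := by
    rw [← Int.cast_prod, ← Units.coe_prod, hb]
    simp
  rw [Fintype.prod_sum_type] at h6
  simp only [← h5] at h6
  -- Over ℂ the row products and the column products both multiply to the product of all nine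
  -- values, so the total sign is a square, which turns `h6` into 1 = -1.
  rw [Finset.prod_comm] at h6
  simp only [h1] at h6
  rw [← Finset.prod_mul_distrib] at h6
  simp only [h5, ← Int.cast_mul, ← Units.val_mul, Int.units_mul_self] at h6
  norm_num at h6

end K33

/-! ### Perfect strategies from matrix-valued quantum isomorphisms -/

section Strategy

open scoped Kronecker

variable {V V' : Type*} [Fintype V] [Fintype V'] {G : SimpleGraph V} {G' : SimpleGraph V'}
  {N : Type} [Fintype N] [DecidableEq N]

/-- The measurement operators of the isomorphism game given by a magic unitary. -/
def gameOperator {A : Type*} [Zero A] (u : V → V' → A) : V ⊕ V' → V ⊕ V' → A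
  | .inl x, .inr x' => u x x'
  | .inr x', .inl x => u x x'
  | .inl _, .inl _ => 0
  | .inr _, .inr _ => 0

theorem IsQuantumIso.sum_gameOperator {A : Type*} [Ring A] {u : V → V' → A}
    (hu : IsQuantumIso G G' u) (x : V ⊕ V') : ∑ y, gameOperator u x y = 1 := by
  rcases x with x | x
  · simp [gameOperator, hu.row_sum]
  · simp [gameOperator, hu.col_sum]

theorem IsQuantumIso.isoGameWins {A : Type*} [Ring A] {u : V → V' → A}
    (hu : IsQuantumIso G G' u) {xa xb ya yb : V ⊕ V'}
    (h : gameOperator u xa ya * gameOperator u xb yb ≠ 0) : IsoGameWins G G' xa xb ya yb := by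
  have key : ∀ {x y : V ⊕ V'}, gameOperator u x y ≠ 0 → ∃ g g',
      ((x = .inl g ∧ y = .inr g') ∨ (x = .inr g' ∧ y = .inl g)) ∧ gameOperator u x y = u g g' := by
    rintro (x | x) (y | y) h
    · exact absurd rfl h
    · exact ⟨x, y, by simp, rfl⟩
    · exact ⟨y, x, by simp, rfl⟩
    · exact absurd rfl h
  obtain ⟨ga, ga', ha, ea⟩ := key (left_ne_zero_of_mul h)
  obtain ⟨gb, gb', hb, eb⟩ := key (right_ne_zero_of_mul h)
  rw [ea, eb] at h
  exact ⟨ga, gb, ga', gb', ha, hb, hu.compat h⟩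

/-- Left multiplication on `N × N` matrices, as an operator on a Hilbert space. -/
noncomputable def leftOperator (a : Matrix N N ℂ) : EuclideanSpace ℂ (N × N) →L[ℂ] EuclideanSpace ℂ (N × N) :=
  Matrix.toEuclideanCLM (𝕜 := ℂ) (n := N × N) (a ⊗ₖ (1 : Matrix N N ℂ))

/-- Right multiplication on `N × N` matrices, as an operator on a Hilbert space. -/
noncomputable def rightOperator (a : Matrix N N ℂ) : EuclideanSpace ℂ (N × N) →L[ℂ] EuclideanSpace ℂ (N × N) :=
  Matrix.toEuclideanCLM (𝕜 := ℂ) (n := N × N) ((1 : Matrix N N ℂ) ⊗ₖ a.transpose)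

theorem leftOperator_one : leftOperator (1 : Matrix N N ℂ) = 1 := by
  rw [leftOperator, Matrix.one_kronecker_one, map_one]

theorem rightOperator_one : rightOperator (1 : Matrix N N ℂ) = 1 := by
  rw [rightOperator, Matrix.transpose_one, Matrix.one_kronecker_one, map_one]

theorem leftOperator_mul (a b : Matrix N N ℂ) :
    leftOperator (a * b) = leftOperator a * leftOperator b := by
  rw [leftOperator, leftOperator, leftOperator, ← map_mul, ← Matrix.mul_kronecker_mul, one_mul]

theorem rightOperator_mul (a b : Matrix N N ℂ) :
    rightOperator (a * b) = rightOperator b * rightOperator a := by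
  rw [rightOperator, rightOperator, rightOperator, ← map_mul, ← Matrix.mul_kronecker_mul, one_mul,
    Matrix.transpose_mul]

theorem leftOperator_sum {ι : Type*} (s : Finset ι) (a : ι → Matrix N N ℂ) :
    leftOperator (∑ i ∈ s, a i) = ∑ i ∈ s, leftOperator (a i) := by
  have : (∑ i ∈ s, a i) ⊗ₖ (1 : Matrix N N ℂ) = ∑ i ∈ s, a i ⊗ₖ (1 : Matrix N N ℂ) := by
    ext i j
    simp [Matrix.sum_apply, Finset.sum_mul]
  simp only [leftOperator, this, map_sum]

theorem rightOperator_sum {ι : Type*} (s : Finset ι) (a : ι → Matrix N N ℂ) :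
    rightOperator (∑ i ∈ s, a i) = ∑ i ∈ s, rightOperator (a i) := by
  have : (1 : Matrix N N ℂ) ⊗ₖ (∑ i ∈ s, a i).transpose =
      ∑ i ∈ s, (1 : Matrix N N ℂ) ⊗ₖ (a i).transpose := by
    ext i j
    simp [Matrix.sum_apply, Finset.mul_sum]
  simp only [rightOperator, this, map_sum]

theorem leftOperator_commute (a b : Matrix N N ℂ) :
    leftOperator a * rightOperator b = rightOperator b * leftOperator a := by
  rw [leftOperator, rightOperator, ← map_mul, ← map_mul, ← Matrix.mul_kronecker_mul,
    ← Matrix.mul_kronecker_mul, one_mul, mul_one, one_mul, mul_one]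

theorem leftOperator_isPositive {a : Matrix N N ℂ} (h : IsStarProjection a) :
    (leftOperator a).IsPositive := by
  refine .of_isStarProjection ⟨?_, ?_⟩
  · rw [IsIdempotentElem, ← leftOperator_mul, h.isIdempotentElem.eq]
  · rw [IsSelfAdjoint, leftOperator, ← map_star, Matrix.star_eq_conjTranspose,
      Matrix.conjTranspose_kronecker, ← Matrix.star_eq_conjTranspose, h.isSelfAdjoint.star_eq,
      Matrix.conjTranspose_one]

theorem rightOperator_isPositive {a : Matrix N N ℂ} (h : IsStarProjection a) :
    (rightOperator a).IsPositive := by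
  refine .of_isStarProjection ⟨?_, ?_⟩
  · rw [IsIdempotentElem, ← rightOperator_mul, h.isIdempotentElem.eq]
  · rw [IsSelfAdjoint, rightOperator, ← map_star, Matrix.star_eq_conjTranspose,
      Matrix.conjTranspose_kronecker, Matrix.conjTranspose_one,
      show a.transpose.conjTranspose = a.transpose from
        congrArg Matrix.transpose h.isSelfAdjoint.star_eq]

variable (N) in
/-- The maximally entangled vector, up to normalization. -/
noncomputable def entangledVector : EuclideanSpace ℂ (N × N) :=
  WithLp.toLp 2 fun p => if p.1 = p.2 then 1 else 0

/-- As an N × N matrix the entangled vector is the identity, so left and right multiplication by `a`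
both give `a`. This moves Bob's measurement to Alice's side. -/
theorem leftOperator_entangledVector (a : Matrix N N ℂ) :
    leftOperator a (entangledVector N) = rightOperator a (entangledVector N) := by
  ext ⟨i, j⟩
  simp [leftOperator, rightOperator, entangledVector, Matrix.mulVec, dotProduct,
    Fintype.sum_prod_type, Matrix.one_apply]

omit [Fintype N] in
theorem entangledVector_ne_zero [Nonempty N] : entangledVector N ≠ 0 := by
  obtain ⟨i⟩ := ‹Nonempty N›
  intro h
  have := congrArg (fun v : EuclideanSpace ℂ (N × N) => v (i, i)) h
  simp [entangledVector] at this

/-- A finite-dimensional quantum isomorphism yields a perfect strategy for the isomorphism game. -/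
theorem IsQuantumIso.quantumIsomorphic [Nonempty N] {u : V → V' → Matrix N N ℂ}
    (hu : IsQuantumIso G G' u) (hs : ∀ x x', IsSelfAdjoint (u x x')) :
    QuantumIsomorphic G G' := by
  have hp : ∀ x y, IsStarProjection (gameOperator u x y) := by
    rintro (x | x) (y | y)
    · exact IsStarProjection.zero _
    · exact ⟨hu.mul_self x y, hs x y⟩
    · exact ⟨hu.mul_self y x, hs y x⟩
    · exact IsStarProjection.zero _
  let ψ : EuclideanSpace ℂ (N × N) := ((‖entangledVector N‖⁻¹ : ℝ) : ℂ) • entangledVector N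
  have hψ : ‖ψ‖ = 1 := by
    have := norm_ne_zero_iff.2 (entangledVector_ne_zero (N := N))
    simp [ψ, norm_smul, this]
  refine ⟨{
    H := EuclideanSpace ℂ (N × N)
    ψ := ψ
    E := fun x y => leftOperator (gameOperator u x y)
    F := fun x y => rightOperator (gameOperator u x y)
    norm_ψ := hψ
    E_pos := fun x y => leftOperator_isPositive (hp x y)
    F_pos := fun x y => rightOperator_isPositive (hp x y)
    E_sum := fun x => by rw [← leftOperator_sum, hu.sum_gameOperator, leftOperator_one]
    F_sum := fun x => by rw [← rightOperator_sum, hu.sum_gameOperator, rightOperator_one]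
    comm := fun x y x' y' => leftOperator_commute _ _ }, fun xa xb => ?_⟩
  have h1 : ∀ a, rightOperator a ψ = leftOperator a ψ := fun a => by
    simp only [ψ, map_smul, leftOperator_entangledVector]
  simp only [CommutingStrategy.prob, h1]
  -- Losing answers have operator product 0, so the winning condition can be dropped; the full sum
  -- is then ⟨ψ, ψ⟩ = 1.
  have h2 : ∀ ya yb, (open Classical in if IsoGameWins G G' xa xb ya yb then
      inner ℂ ψ (leftOperator (gameOperator u xa ya) (leftOperator (gameOperator u xb yb) ψ)) else 0) =
      inner ℂ ψ (leftOperator (gameOperator u xa ya) (leftOperator (gameOperator u xb yb) ψ)) := by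
    intro ya yb
    split_ifs with h
    · rfl
    · rw [← mul_apply_eq_comp, ← leftOperator_mul,
        show gameOperator u xa ya * gameOperator u xb yb = 0 from
          by_contra fun h' => h (hu.isoGameWins h')]
      simp [leftOperator]
  simp only [h2, ← inner_sum, ← map_sum, ← sum_apply, ← leftOperator_sum,
    hu.sum_gameOperator, leftOperator_one, one_apply_eq_self]
  rw [inner_self_eq_norm_sq_to_K, hψ]
  simp

end Strategy

/-! ### The Mermin–Peres square with prescribed signs -/

section Pauli

/-- The Mermin–Peres magic square. -/
def merminSquare : Fin 3 → Fin 3 → Matrix (Fin 4) (Fin 4) ℤ :=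
  ![![!![0, 0, 1, 0; 0, 0, 0, 1; 1, 0, 0, 0; 0, 1, 0, 0],
      !![0, 1, 0, 0; 1, 0, 0, 0; 0, 0, 0, 1; 0, 0, 1, 0],
      !![0, 0, 0, 1; 0, 0, 1, 0; 0, 1, 0, 0; 1, 0, 0, 0]],
    ![!![1, 0, 0, 0; 0, -1, 0, 0; 0, 0, 1, 0; 0, 0, 0, -1],
      !![1, 0, 0, 0; 0, 1, 0, 0; 0, 0, -1, 0; 0, 0, 0, -1],
      !![1, 0, 0, 0; 0, -1, 0, 0; 0, 0, -1, 0; 0, 0, 0, 1]],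
    ![!![0, 0, 1, 0; 0, 0, 0, -1; 1, 0, 0, 0; 0, -1, 0, 0],
      !![0, 1, 0, 0; 1, 0, 0, 0; 0, 0, 0, -1; 0, 0, -1, 0],
      !![0, 0, 0, -1; 0, 0, 1, 0; 0, 1, 0, 0; -1, 0, 0, 0]]]

/-- The signs that turn the Mermin–Peres square into a solution with given right hand sides. -/
def squareSign (s : Fin 3 ⊕ Fin 3 → ℤˣ) : Fin 3 → Fin 3 → ℤˣ :=
  ![![1, 1, s (.inl 0)], ![1, 1, s (.inl 1)],
    ![s (.inr 0), s (.inr 1), s (.inl 2) * s (.inr 0) * s (.inr 1)]]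

/-- The entries are tensor products of Pauli matrices. Y enters only through Y ⊗ Y, so everything is
integral and decidable. -/
theorem merminSquare_facts :
    (∀ i j j', merminSquare i j * merminSquare i j' = merminSquare i j' * merminSquare i j) ∧
    (∀ i i' j, merminSquare i j * merminSquare i' j = merminSquare i' j * merminSquare i j) ∧
    (∀ i j, merminSquare i j * merminSquare i j = 1) ∧
    (∀ i j, (merminSquare i j).transpose = merminSquare i j) ∧
    (∀ i, merminSquare i 0 * merminSquare i 1 * merminSquare i 2 = 1) ∧
    (∀ j, merminSquare 0 j * merminSquare 1 j * merminSquare 2 j = if j = 2 then -1 else 1) := by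
  decide +kernel

/-- Changing signs of entries preserves the product of the six right-hand signs, which is -1 for the
Mermin–Peres square, and imposes no other restriction. -/
theorem exists_magicSquare (s : Fin 3 ⊕ Fin 3 → ℤˣ) (hs : ∏ k, s k = -1) :
    ∃ X : Fin 3 ⊕ Fin 3 → Fin 3 → Matrix (Fin 4) (Fin 4) ℂ,
      (∀ i j, X (.inl i) j = X (.inr j) i) ∧ (∀ k i j, Commute (X k i) (X k j)) ∧
      (∀ k i, X k i * X k i = 1) ∧ (∀ k i, IsSelfAdjoint (X k i)) ∧
      ∀ k, X k 0 * X k 1 * X k 2 = (((s k : ℤˣ) : ℤ) : ℂ) • 1 := by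
  obtain ⟨f1, f2, f3, f4, f5, f6⟩ := merminSquare_facts
  let φ : Matrix (Fin 4) (Fin 4) ℤ →+* Matrix (Fin 4) (Fin 4) ℂ := (Int.castRingHom ℂ).mapMatrix
  let Y : Fin 3 → Fin 3 → Matrix (Fin 4) (Fin 4) ℂ := fun i j =>
    ((squareSign s i j : ℤ) : ℂ) • φ (merminSquare i j)
  have hsq : ∀ t : ℤˣ, ((t : ℤ) : ℂ) * ((t : ℤ) : ℂ) = 1 := fun t => by
    rw [← Int.cast_mul, ← Units.val_mul, Int.units_mul_self]
    simp
  have hprod : ∀ (t₁ t₂ t₃ : ℤˣ) (a b c : Matrix (Fin 4) (Fin 4) ℤ),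
      ((t₁ : ℤ) : ℂ) • φ a * ((t₂ : ℤ) : ℂ) • φ b * ((t₃ : ℤ) : ℂ) • φ c =
      (((t₁ * t₂ * t₃ : ℤˣ) : ℤ) : ℂ) • φ (a * b * c) := fun t₁ t₂ t₃ a b c => by
    rw [smul_mul_smul_comm, smul_mul_smul_comm, map_mul, map_mul]
    push_cast
    rfl
  have hY1 : ∀ i j j', Commute (Y i j) (Y i j') := fun i j j' =>
    (Commute.smul_right (Commute.smul_left (by
      rw [Commute, SemiconjBy, ← map_mul, ← map_mul, f1]) _) _)
  have hY2 : ∀ i i' j, Commute (Y i j) (Y i' j) := fun i j j' =>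
    (Commute.smul_right (Commute.smul_left (by
      rw [Commute, SemiconjBy, ← map_mul, ← map_mul, f2]) _) _)
  have hY3 : ∀ i j, Y i j * Y i j = 1 := fun i j => by
    rw [smul_mul_smul_comm, hsq, ← map_mul, f3, map_one, one_smul]
  have hY4 : ∀ i j, IsSelfAdjoint (Y i j) := fun i j => by
    ext a b
    have := congrFun (congrFun (f4 i j) a) b
    rw [Matrix.transpose_apply] at this
    simp [Y, φ, this, Matrix.star_apply]
  refine ⟨fun k j => match k with
    | .inl i => Y i j
    | .inr i => Y j i, fun _ _ => rfl, ?_, ?_, ?_, ?_⟩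
  · rintro (k | k) i j
    · exact hY1 _ _ _
    · exact hY2 _ _ _
  · rintro (k | k) i
    · exact hY3 _ _
    · exact hY3 _ _
  · rintro (k | k) i
    · exact hY4 _ _
    · exact hY4 _ _
  · rintro (k | k)
    · have e : squareSign s k 0 * squareSign s k 1 * squareSign s k 2 = s (.inl k) := by
        fin_cases k
        · simp [squareSign]
        · simp [squareSign]
        · change s (.inr 0) * s (.inr 1) * (s (.inl 2) * s (.inr 0) * s (.inr 1)) = s (.inl 2)
          calc _ = (s (.inr 0) * s (.inr 0)) * (s (.inr 1) * s (.inr 1)) * s (.inl 2) := by ac_rfl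
            _ = _ := by simp [Int.units_mul_self]
      change Y k 0 * Y k 1 * Y k 2 = _
      rw [hprod, f5, map_one, e]
    · change Y 0 k * Y 1 k * Y 2 k = _
      rw [hprod, f6]
      fin_cases k
      · simp [squareSign]
      · simp [squareSign]
      -- The signs were chosen to fit the other five equations; `hs` determines the last column, and
      -- the minus sign cancels that of the square.
      · have e : squareSign s 0 2 * squareSign s 1 2 * squareSign s 2 2 = - s (.inr 2) := by
          rw [Fintype.prod_sum_type, Fin.prod_univ_three, Fin.prod_univ_three] at hs
          have : squareSign s 0 2 * squareSign s 1 2 * squareSign s 2 2 =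
              (s (.inl 0) * s (.inl 1) * s (.inl 2) * (s (.inr 0) * s (.inr 1) * s (.inr 2))) *
              s (.inr 2) := by
            simp only [squareSign, Matrix.cons_val]
            calc _ = (s (.inl 0) * s (.inl 1) * s (.inl 2) * (s (.inr 0) * s (.inr 1))) *
                  (s (.inr 2) * s (.inr 2)) := by
                  rw [Int.units_mul_self, mul_one]
                  ac_rfl
              _ = _ := by ac_rfl
          rw [this, hs, neg_one_mul]
        simp [e]

end Pauli

/-! ### Transport of decolored graphs along bijections -/

section DecolorEquiv

variable {V V' K C : Type*} {G : ColoredGraph V K C} {G' : ColoredGraph V' K C} {c₀ : C}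
  {n : K → ℕ} {m : C → ℕ}

/-- The bijection of decolored graphs induced by a bijection that preserves the vertex colors and
the colored edges, except possibly those of color `c₀`. -/
def decolorEquiv (f : V ≃ V') (hv : ∀ v, G.vertexColor v = G'.vertexColor (f v))
    (he : ∀ e : Sym2 V, (e ∈ G.graph.edgeSet ∧ G.edgeColor e ≠ c₀) ↔
      (e.map f ∈ G'.graph.edgeSet ∧ G'.edgeColor (e.map f) ≠ c₀))
    (hc : ∀ e : Sym2 V, e ∈ G.graph.edgeSet ∧ G.edgeColor e ≠ c₀ →
      G.edgeColor e = G'.edgeColor (e.map f)) :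
    DecoloredVertex G c₀ n m ≃ DecoloredVertex G' c₀ n m :=
  Equiv.sumCongr (Equiv.sigmaCongr f fun v => finCongr (by rw [hv]))
    (Equiv.sigmaCongr (Equiv.subtypeEquiv
      ⟨Sym2.map f, Sym2.map f.symm, fun e => by simp [Sym2.map_map], fun e => by
        simp [Sym2.map_map]⟩ he)
      fun e => finCongr (congrArg (m · + 1) (hc e.1 e.2)))

variable {f : V ≃ V'} {hv : ∀ v, G.vertexColor v = G'.vertexColor (f v)}
    {he : ∀ e : Sym2 V, (e ∈ G.graph.edgeSet ∧ G.edgeColor e ≠ c₀) ↔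
      (e.map f ∈ G'.graph.edgeSet ∧ G'.edgeColor (e.map f) ≠ c₀)}
    {hc : ∀ e : Sym2 V, e ∈ G.graph.edgeSet ∧ G.edgeColor e ≠ c₀ →
      G.edgeColor e = G'.edgeColor (e.map f)}

theorem decolorEquiv_inl (v i) : decolorEquiv (n := n) (m := m) f hv he hc (.inl ⟨v, i⟩) =
    .inl ⟨f v, Fin.cast (by rw [hv]) i⟩ := rfl

theorem decolorEquiv_inr (e i) : decolorEquiv (n := n) (m := m) f hv he hc (.inr ⟨e, i⟩) =
    .inr ⟨⟨e.val.map f, (he e).1 e.2⟩, Fin.cast (congrArg (m · + 1) (hc e.1 e.2)) i⟩ := rfl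

/-- Paths and subdivisions are carried along automatically; only edges of color `c₀` between
original vertices need to be checked, and only for the given pair. -/
theorem decolorEquiv_adj {x y : DecoloredVertex G c₀ n m}
    (h : ∀ v w, x = decoloredRoot v → y = decoloredRoot w →
      ((G.graph.Adj v w ∧ G.edgeColor s(v, w) = c₀) ↔
        (G'.graph.Adj (f v) (f w) ∧ G'.edgeColor s(f v, f w) = c₀))) :
    (G'.decolor c₀ n m).Adj (decolorEquiv f hv he hc x) (decolorEquiv f hv he hc y) ↔
      (G.decolor c₀ n m).Adj x y := by
  have hmem : ∀ (v : V) (e : Sym2 V), f v ∈ e.map f ↔ v ∈ e := fun v e => by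
    simp [Sym2.mem_map]
  have hinj : Function.Injective (Sym2.map f) := Sym2.map.injective f.injective
  rcases x with ⟨v, i⟩ | ⟨e, i⟩ <;> rcases y with ⟨w, j⟩ | ⟨e', j⟩
  · rw [decolorEquiv_inl, decolorEquiv_inl, decolor_adj_inl_inl, decolor_adj_inl_inl]
    refine or_congr (by simp) ?_
    by_cases hi : i = 0
    · by_cases hj : j = 0
      · subst hi hj
        simpa using (h v w rfl rfl).symm
      · have : j.val ≠ 0 := fun h => hj (Fin.ext h)
        simp [this]
    · have : i.val ≠ 0 := fun h => hi (Fin.ext h)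
      simp [this]
  · rw [decolorEquiv_inl, decolorEquiv_inr, decolor_adj_inl_inr, decolor_adj_inl_inr, hmem]
    rfl
  · rw [decolorEquiv_inl, decolorEquiv_inr, decolor_adj_inr_inl, decolor_adj_inr_inl, hmem]
    rfl
  · rw [decolorEquiv_inr, decolorEquiv_inr, decolor_adj_inr_inr, decolor_adj_inr_inr]
    refine and_congr ?_ Iff.rfl
    rw [Subtype.mk.injEq, hinj.eq_iff, Subtype.ext_iff]

end DecolorEquiv

/-! ### Translation by local solutions -/

section Translation

variable {K E : Type*} [Fintype E] [DecidableEq E] {M : Matrix K E (ZMod 2)} {b : K → ZMod 2}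
  {n : K → ℕ} {m : StarColor E → ℕ}

/-- A choice of a solution for every equation. -/
abbrev LocalSolution (M : Matrix K E (ZMod 2)) (b : K → ZMod 2) : Type _ :=
  ∀ k, {α : eqnSupport M k → ℤˣ // ∏ i, α i = (-1) ^ (b k).val}

/-- Translation by a local solution. -/
def systemTranslate (s : LocalSolution M b) : SystemVertex M 0 ≃ SystemVertex M b :=
  Equiv.sigmaCongrRight fun k =>
    { toFun := fun α => ⟨fun i => α.1 i * (s k).1 i, by
        rw [Finset.prod_mul_distrib, α.2, (s k).2]
        simp⟩
      invFun := fun α => ⟨fun i => α.1 i * (s k).1 i, by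
        rw [Finset.prod_mul_distrib, α.2, (s k).2, Int.units_mul_self]
        simp⟩
      left_inv := fun α => Subtype.ext (funext fun i => by
        change α.1 i * (s k).1 i * (s k).1 i = α.1 i
        rw [mul_assoc, Int.units_mul_self, mul_one])
      right_inv := fun α => Subtype.ext (funext fun i => by
        change α.1 i * (s k).1 i * (s k).1 i = α.1 i
        rw [mul_assoc, Int.units_mul_self, mul_one]) }

theorem vertexColor_systemTranslate (s : LocalSolution M b) (v) :
    (starGraph M 0).vertexColor v = (starGraph M b).vertexColor (systemTranslate s v) := rfl

omit [DecidableEq E] in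
theorem systemTranslate_congr {s s' : LocalSolution M b} {v : SystemVertex M 0} (h : s v.1 = s' v.1) :
    systemTranslate s v = systemTranslate s' v := by
  obtain ⟨k, α⟩ := v
  have h : s k = s' k := h
  refine congrArg (Sigma.mk k) (Subtype.ext (funext fun i => ?_))
  change α.1 i * (s k).1 i = α.1 i * (s' k).1 i
  rw [h]

/-- The solutions `s k` and `s l` agree on the common variables of the equations. -/
def LocalSolution.Agree (s : LocalSolution M b) (k l : K) : Prop :=
  ∀ e (hk : e ∈ eqnSupport M k) (hl : e ∈ eqnSupport M l), (s k).1 ⟨e, hk⟩ = (s l).1 ⟨e, hl⟩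

omit [DecidableEq E] in
theorem LocalSolution.agree_of_eq (s : LocalSolution M b) {k l : K} (h : k = l) : s.Agree k l := by
  subst h
  exact fun _ _ _ => rfl

/-- On a common variable both factors are multiplied by the same sign, which cancels. -/
theorem signProd_translate {s : LocalSolution M b} {v w : SystemVertex M 0} (h : s.Agree v.1 w.1) :
    signProd (systemTranslate s v) (systemTranslate s w) = signProd v w := by
  refine congrArg (Sigma.mk (eqnSupport M v.1 ∩ eqnSupport M w.1)) (funext fun i => ?_)
  have hi := Finset.mem_inter.1 i.2
  change v.2.1 ⟨i, hi.1⟩ * (s v.1).1 ⟨i, hi.1⟩ * (w.2.1 ⟨i, hi.2⟩ * (s w.1).1 ⟨i, hi.2⟩) =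
    v.2.1 ⟨i, hi.1⟩ * w.2.1 ⟨i, hi.2⟩
  rw [h i hi.1 hi.2, mul_mul_mul_comm, Int.units_mul_self, mul_one]

theorem starColor_translate {s : LocalSolution M b} {v w : SystemVertex M 0}
    (h : s.Agree v.1 w.1) :
    starColor M b s(systemTranslate s v, systemTranslate s w) = starColor M 0 s(v, w) := by
  by_cases hvw : v.1 = w.1
  · rw [starColor_of_eq hvw, starColor_of_eq (v := systemTranslate s v) (z := systemTranslate s w) hvw,
      signProd_translate h]
  · rw [starColor_of_ne hvw, starColor_of_ne (v := systemTranslate s v) (z := systemTranslate s w) hvw,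
      signProd_translate h]

theorem starGraph_adj_translate {s : LocalSolution M b} {v w : SystemVertex M 0}
    (h : s.Agree v.1 w.1) :
    (starGraph M b).graph.Adj (systemTranslate s v) (systemTranslate s w) ↔ (starGraph M 0).graph.Adj v w := by
  rw [starGraph_adj, starGraph_adj, starColor_translate h, (systemTranslate s).injective.ne_iff]
  rfl

/-- Edges between different equations have color ±1, and those of color 1 were deleted. Thus
subdivided edges stay inside one equation, and any local solution, even an inconsistent one,
transports them. -/
theorem starGraph_edge_fst_eq {v w : SystemVertex M b}
    (h : (starGraph M b).graph.Adj v w ∧ (starGraph M b).edgeColor s(v, w) ≠ .inl (-1)) :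
    v.1 = w.1 := by
  by_contra hvw
  have h1 := h.1.2
  have h2 := h.2
  rw [starGraph_edgeColor] at h2
  rw [starColor_of_ne hvw] at h1 h2
  rcases Int.units_eq_one_or (signProd v w).total with h | h
  · exact h1 (congrArg _ h)
  · exact h2 (congrArg _ h)

theorem starGraph_edge_translate (s : LocalSolution M b) (e : Sym2 (SystemVertex M 0)) :
    (e ∈ (starGraph M 0).graph.edgeSet ∧ (starGraph M 0).edgeColor e ≠ .inl (-1)) ↔
      (e.map (systemTranslate s) ∈ (starGraph M b).graph.edgeSet ∧
        (starGraph M b).edgeColor (e.map (systemTranslate s)) ≠ .inl (-1)) := by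
  induction e with
  | _ v w =>
    rw [Sym2.map_mk, SimpleGraph.mem_edgeSet, SimpleGraph.mem_edgeSet]
    by_cases hvw : v.1 = w.1
    · rw [starGraph_adj_translate (s.agree_of_eq hvw), starGraph_edgeColor, starGraph_edgeColor,
        starColor_translate (s.agree_of_eq hvw)]
    · exact iff_of_false (fun h => hvw (starGraph_edge_fst_eq h))
        fun h => hvw (starGraph_edge_fst_eq (v := systemTranslate s v) (w := systemTranslate s w) h)

theorem starGraph_edgeColor_translate (s : LocalSolution M b) (e : Sym2 (SystemVertex M 0))
    (he : e ∈ (starGraph M 0).graph.edgeSet ∧ (starGraph M 0).edgeColor e ≠ .inl (-1)) :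
    (starGraph M 0).edgeColor e = (starGraph M b).edgeColor (e.map (systemTranslate s)) := by
  induction e with
  | _ v w =>
    rw [Sym2.map_mk, starGraph_edgeColor, starGraph_edgeColor,
      starColor_translate (s.agree_of_eq (starGraph_edge_fst_eq he))]

/-- The bijection of decolored graphs given by translation by a local solution. -/
noncomputable def decoloredTranslate (s : LocalSolution M b) :
    DecoloredVertex (starGraph M 0) (Sum.inl (-1)) n m ≃
      DecoloredVertex (starGraph M b) (Sum.inl (-1)) n m :=
  decolorEquiv (systemTranslate s) (vertexColor_systemTranslate s) (starGraph_edge_translate s)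
    (starGraph_edgeColor_translate s)

/-- The equation that a vertex of the decolored graph belongs to. -/
noncomputable def decoloredEqn :
    DecoloredVertex (starGraph M b) (Sum.inl (-1)) n m → K
  | .inl ⟨v, _⟩ => v.1
  | .inr ⟨e, _⟩ => e.val.out.1.1

/-- Both endpoints of a subdivided edge lie over one equation, so the endpoint chosen by `out` in
`decoloredEqn` is immaterial. -/
theorem fst_eq_decoloredEqn {v : SystemVertex M b}
    {e : {e // e ∈ (starGraph M b).graph.edgeSet ∧ (starGraph M b).edgeColor e ≠ .inl (-1)}}
    (h : v ∈ e.val) (i) : v.1 =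
      decoloredEqn (.inr ⟨e, i⟩ : DecoloredVertex (starGraph M b) (Sum.inl (-1)) n m) := by
  have key : ∀ v ∈ e.val, ∀ w ∈ e.val, v.1 = w.1 := by
    obtain ⟨⟨x, y⟩, he⟩ := e
    have := starGraph_edge_fst_eq he
    intro v hv w hw
    rcases Sym2.mem_iff.1 hv with rfl | rfl <;> rcases Sym2.mem_iff.1 hw with rfl | rfl <;>
      first | rfl | exact this | exact this.symm
  exact key _ h _ (Sym2.out_fst_mem _)

theorem decoloredEqn_translate (s : LocalSolution M b)
    (x : DecoloredVertex (starGraph M 0) (Sum.inl (-1)) n m) :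
    decoloredEqn (decoloredTranslate s x) = decoloredEqn x := by
  rcases x with ⟨v, i⟩ | ⟨e, i⟩
  · rfl
  · rw [decoloredTranslate, decolorEquiv_inr, ← fst_eq_decoloredEqn (v := systemTranslate s e.val.out.1)
      (Sym2.mem_map.2 ⟨_, Sym2.out_fst_mem _, rfl⟩)]
    rfl

theorem decoloredTranslate_congr {s s' : LocalSolution M b}
    {x : DecoloredVertex (starGraph M 0) (Sum.inl (-1)) n m}
    (h : s (decoloredEqn x) = s' (decoloredEqn x)) :
    decoloredTranslate s x = decoloredTranslate s' x := by
  rcases x with ⟨v, i⟩ | ⟨e, i⟩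
  · exact decolored_inl_ext (systemTranslate_congr h) rfl
  · refine decolored_inr_ext (Subtype.ext (Sym2.map_congr fun v hv => systemTranslate_congr ?_)) rfl
    rw [fst_eq_decoloredEqn hv i]
    exact h

theorem decoloredTranslate_adj {s : LocalSolution M b}
    {x y : DecoloredVertex (starGraph M 0) (Sum.inl (-1)) n m}
    (h : s.Agree (decoloredEqn x) (decoloredEqn y)) :
    ((starGraph M b).decolor (Sum.inl (-1)) n m).Adj (decoloredTranslate s x)
      (decoloredTranslate s y) ↔ ((starGraph M 0).decolor (Sum.inl (-1)) n m).Adj x y := by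
  refine decolorEquiv_adj ?_
  rintro v w rfl rfl
  rw [starGraph_adj_translate h, starGraph_edgeColor, starGraph_edgeColor, starColor_translate h]

section Family

variable [Fintype K] {A : Type*} [Ring A] {q : SystemVertex M b → A}

/-- Change a local solution at one equation. -/
noncomputable def LocalSolution.set (s : LocalSolution M b) (v : SystemVertex M b) : LocalSolution M b :=
  open Classical in Function.update s v.1 v.2

omit [DecidableEq E] [Fintype K] in
theorem LocalSolution.set_fst (s : LocalSolution M b) (v : SystemVertex M b) :
    s.set v v.1 = v.2 :=
  by classical exact Function.update_self _ _ _

omit [DecidableEq E] [Fintype K] in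
theorem LocalSolution.set_of_ne (s : LocalSolution M b) {v : SystemVertex M b} {k : K}
    (h : k ≠ v.1) : s.set v k = s k :=
  by classical exact Function.update_of_ne h _ _

open Classical in
/-- The magic unitary obtained from a family of projections indexed by the solutions of the
individual equations. -/
noncomputable def translationUnitary (s : LocalSolution M b) (q : SystemVertex M b → A)
    (x : DecoloredVertex (starGraph M 0) (Sum.inl (-1)) n m)
    (x' : DecoloredVertex (starGraph M b) (Sum.inl (-1)) n m) : A :=
  ∑ ω, if ω.1 = decoloredEqn x ∧ decoloredTranslate (s.set ω) x = x' then q ω else 0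

/-- Each ω over the equation of x carries x to exactly one x', so row and column sums reduce to
`hsum`. The background solution `s` is only filler: a translation depends on the local solution at
the equation of the vertex. -/
theorem isQuantumIso_translationUnitary (s : LocalSolution M b)
    (hsum : ∀ k, open Classical in ∑ ω, (if ω.1 = k then q ω else 0) = 1)
    (hq : ∀ ω ω', q ω * q ω' ≠ 0 → ∀ e ∈ eqnSupport M ω.1, e ∈ eqnSupport M ω'.1 →
      systemSign ω e = systemSign ω' e) :
    IsQuantumIso ((starGraph M 0).decolor (Sum.inl (-1)) n m)
      ((starGraph M b).decolor (Sum.inl (-1)) n m) (translationUnitary s q) where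
  row_sum x := by
    classical
    simp only [translationUnitary]
    rw [Finset.sum_comm, ← hsum (decoloredEqn x)]
    refine Finset.sum_congr rfl fun ω _ => ?_
    rw [Fintype.sum_eq_single (decoloredTranslate (s.set ω) x)
      fun x' hx' => if_neg fun h => hx' h.2.symm]
    simp
  col_sum x' := by
    classical
    simp only [translationUnitary]
    rw [Finset.sum_comm, ← hsum (decoloredEqn x')]
    refine Finset.sum_congr rfl fun ω _ => ?_
    obtain ⟨x, rfl⟩ := (decoloredTranslate (s.set ω)).surjective x'
    rw [Fintype.sum_eq_single x fun y hy => if_neg fun h => hy (Equiv.injective _ h.2),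
      decoloredEqn_translate]
    simp
  compat {x y x' y'} h := by
    classical
    rw [translationUnitary, translationUnitary, Finset.sum_mul_sum] at h
    obtain ⟨ω, -, hω⟩ := Finset.exists_ne_zero_of_sum_ne_zero h
    obtain ⟨ω', -, hω'⟩ := Finset.exists_ne_zero_of_sum_ne_zero hω
    clear h hω
    split_ifs at hω' with h1 h2 h2
    · obtain ⟨hx, rfl⟩ := h1
      obtain ⟨hy, rfl⟩ := h2
      have hqq := hq ω ω' hω'
      -- A single local solution that induces both translations. If both equations coincide, `hq`
      -- forces ω = ω', so the second update does not spoil the first.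
      let t := (s.set ω).set ω'
      have ty : t ω'.1 = ω'.2 := LocalSolution.set_fst _ _
      have tx : t ω.1 = ω.2 := by
        by_cases hk : ω.1 = ω'.1
        · obtain rfl : ω = ω' := systemVertex_ext hk fun e he => hqq e he (hk ▸ he)
          exact ty
        · rw [← s.set_fst ω]
          exact LocalSolution.set_of_ne _ hk
      have ex : decoloredTranslate (s.set ω) x = decoloredTranslate t x := by
        refine decoloredTranslate_congr ?_
        rw [← hx, tx, LocalSolution.set_fst]
      have ey : decoloredTranslate (s.set ω') y = decoloredTranslate t y := by
        refine decoloredTranslate_congr ?_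
        rw [← hy, ty, LocalSolution.set_fst]
      rw [ex, ey]
      refine ⟨(Equiv.apply_eq_iff_eq _).symm, (decoloredTranslate_adj ?_).symm⟩
      rw [← hx, ← hy]
      intro e he he'
      have := hqq e he he'
      rw [systemSign_coe ω ⟨e, he⟩, systemSign_coe ω' ⟨e, he'⟩] at this
      rw [tx, ty]
      exact this
    all_goals simp at hω'

end Family

end Translation

/-! ### Joint spectral projections of commuting involutions -/

section SignProj

variable {A : Type*} [Ring A] [Algebra ℂ A]

/-- The spectral projection of an involution `x` for the eigenvalue `s`. -/
noncomputable def signProj (x : A) (s : ℤˣ) : A := (1 / 2 : ℂ) • (1 + ((s : ℤ) : ℂ) • x)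

theorem sum_signProj (x : A) : ∑ s, signProj x s = 1 := by
  rw [show (Finset.univ : Finset ℤˣ) = {1, -1} from rfl, Finset.sum_pair (by decide)]
  simp only [signProj, Units.val_one, Int.cast_one, Units.val_neg, Int.cast_neg]
  rw [← smul_add, neg_one_smul, one_smul, add_add_add_comm, add_neg_cancel, add_zero, smul_add,
    ← add_smul]
  norm_num

theorem mul_signProj {x : A} (hx : x * x = 1) (s : ℤˣ) :
    x * signProj x s = ((s : ℤ) : ℂ) • signProj x s := by
  have hs : ((s : ℤ) : ℂ) * ((s : ℤ) : ℂ) = 1 := by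
    rw [← Int.cast_mul, ← Units.val_mul, Int.units_mul_self]
    simp
  rw [signProj, mul_smul_comm, mul_add, mul_one, mul_smul_comm, hx,
    smul_comm ((s : ℤ) : ℂ) (1 / 2 : ℂ)]
  congr 1
  rw [smul_add, smul_smul, hs, one_smul, add_comm]

theorem Commute.signProj_right {x y : A} (h : Commute x y) (s : ℤˣ) : Commute x (signProj y s) :=
  ((Commute.one_right x).add_right (h.smul_right _)).smul_right _

theorem Commute.signProj {x y : A} (h : Commute x y) (s t : ℤˣ) :
    Commute (signProj x s) (signProj y t) :=
  (h.signProj_right t).symm.signProj_right s |>.symm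

theorem isSelfAdjoint_signProj [StarRing A] [StarModule ℂ A] {x : A} (h : IsSelfAdjoint x)
    (s : ℤˣ) : IsSelfAdjoint (signProj x s) := by
  rw [IsSelfAdjoint, _root_.signProj, star_smul, star_add, star_smul, h.star_eq, star_one]
  simp

/-- The joint spectral projection of three involutions. -/
noncomputable def tripleProj (x : Fin 3 → A) (s : Fin 3 → ℤˣ) : A :=
  signProj (x 0) (s 0) * signProj (x 1) (s 1) * signProj (x 2) (s 2)

variable {x : Fin 3 → A} (hc : ∀ i j, Commute (x i) (x j))
include hc

theorem commute_tripleProj (s : Fin 3 → ℤˣ) (j : Fin 3) : Commute (x j) (tripleProj x s) :=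
  (((hc j 0).signProj_right _).mul_right ((hc j 1).signProj_right _)).mul_right
    ((hc j 2).signProj_right _)

theorem mul_tripleProj (hx : ∀ i, x i * x i = 1) (s : Fin 3 → ℤˣ) (j : Fin 3) :
    x j * tripleProj x s = ((s j : ℤ) : ℂ) • tripleProj x s := by
  fin_cases j
  · change x 0 * tripleProj x s = ((s 0 : ℤ) : ℂ) • tripleProj x s
    rw [tripleProj, ← mul_assoc, ← mul_assoc, mul_signProj (hx 0), smul_mul_assoc, smul_mul_assoc]
  · change x 1 * tripleProj x s = ((s 1 : ℤ) : ℂ) • tripleProj x s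
    rw [tripleProj, ((hc 0 1).signProj _ _).eq, ← mul_assoc, ← mul_assoc, mul_signProj (hx 1),
      smul_mul_assoc, smul_mul_assoc]
  · change x 2 * tripleProj x s = ((s 2 : ℤ) : ℂ) • tripleProj x s
    rw [tripleProj, ← (((hc 2 0).signProj (s 2) _).mul_right ((hc 2 1).signProj _ _)).eq, ← mul_assoc,
      mul_signProj (hx 2), smul_mul_assoc]

theorem isSelfAdjoint_tripleProj [StarRing A] [StarModule ℂ A] (hx : ∀ i, IsSelfAdjoint (x i))
    (s : Fin 3 → ℤˣ) : IsSelfAdjoint (tripleProj x s) := by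
  rw [IsSelfAdjoint, tripleProj, star_mul, star_mul,
    (isSelfAdjoint_signProj (hx 0) _).star_eq, (isSelfAdjoint_signProj (hx 1) _).star_eq,
    (isSelfAdjoint_signProj (hx 2) _).star_eq, ((hc 1 0).signProj _ _).eq,
    (((hc 2 0).signProj (s 2) _).mul_right ((hc 2 1).signProj _ _)).eq]

omit hc in
theorem sum_tripleProj (x : Fin 3 → A) :
    ∑ t : ℤˣ × ℤˣ × ℤˣ, tripleProj x ![t.1, t.2.1, t.2.2] = 1 := by
  simp only [Fintype.sum_prod_type, tripleProj, Matrix.cons_val, ← Finset.mul_sum,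
    sum_signProj, mul_one]

/-- The product of the three involutions acts on the projection both as the scalar `r` and as the
product of the signs in `s`. -/
theorem tripleProj_eq_zero (hx : ∀ i, x i * x i = 1) {r : ℤˣ}
    (hr : x 0 * x 1 * x 2 = ((r : ℤ) : ℂ) • 1) {s : Fin 3 → ℤˣ} (hs : s 0 * s 1 * s 2 ≠ r) :
    tripleProj x s = 0 := by
  have h1 : x 0 * x 1 * x 2 * tripleProj x s =
      (((s 0 * s 1 * s 2 : ℤˣ) : ℤ) : ℂ) • tripleProj x s := by
    rw [mul_assoc, mul_tripleProj hc hx, mul_smul_comm, mul_assoc, mul_tripleProj hc hx,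
      mul_smul_comm, mul_tripleProj hc hx, smul_smul, smul_smul]
    congr 1
    push_cast
    ring
  rw [hr, smul_mul_assoc, one_mul, ← sub_eq_zero, ← sub_smul, smul_eq_zero, sub_eq_zero] at h1
  exact h1.resolve_left fun h => hs (Units.ext (by exact_mod_cast h.symm))

end SignProj

/-! ### The quantum isomorphism and the conclusion -/

theorem eq_of_k33Edge_eq {α : Type*} {X : Fin 3 ⊕ Fin 3 → Fin 3 → α}
    (hX : ∀ i j, X (.inl i) j = X (.inr j) i) {k l : Fin 3 ⊕ Fin 3} {i j : Fin 3}
    (h : k33Edge k i = k33Edge l j) : X k i = X l j := by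
  have h := congrArg Subtype.val h
  cases k <;> cases l <;> simp [k33Edge, k33Nbr] at h
  · rw [h.1, h.2]
  · rw [h.1, h.2, hX]
  · rw [h.1, h.2, hX]
  · rw [h.1, h.2]

theorem quantumIsomorphic_starGraph {b : Fin 3 ⊕ Fin 3 → ZMod 2} (hb : ∏ k, eqnSign b k = -1)
    (n : Fin 3 ⊕ Fin 3 → ℕ) (m : StarColor (completeBipartiteGraph (Fin 3) (Fin 3)).edgeSet → ℕ) :
    QuantumIsomorphic ((starGraph incidenceK33 0).decolor (Sum.inl (-1)) n m)
      ((starGraph incidenceK33 b).decolor (Sum.inl (-1)) n m) := by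
  classical
  obtain ⟨X, h1, h2, h3, h4, h5⟩ := exists_magicSquare (eqnSign b) hb
  choose v hv using exists_systemVertex b
  let s : LocalSolution incidenceK33 b := fun k => hv k ▸ (v k).2
  let q : SystemVertex incidenceK33 b → Matrix (Fin 4) (Fin 4) ℂ := fun ω =>
    tripleProj (X ω.1) fun j => systemSign ω (k33Edge ω.1 j)
  have hsum : ∀ k, ∑ ω, (if ω.1 = k then q ω else 0) = 1 := by
    intro k
    -- The projections of all eight sign triples sum to 1. Triples violating equation `k` contribute
    -- 0; the others are exactly the vertices of color `k`.
    rw [← Finset.sum_filter, ← sum_tripleProj (X k)]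
    refine Finset.sum_of_injOn (fun ω => (systemSign ω (k33Edge k 0), systemSign ω (k33Edge k 1),
      systemSign ω (k33Edge k 2))) ?_ (fun _ _ => Finset.mem_univ _) ?_ ?_
    · intro ω hω ω' hω' h
      obtain rfl : ω.1 = k := (Finset.mem_filter.1 hω).2
      have hω' : ω'.1 = ω.1 := (Finset.mem_filter.1 hω').2
      simp only [Prod.mk.injEq] at h
      refine systemVertex_ext hω'.symm fun e he => ?_
      rw [eqnSupport_incidenceK33] at he
      obtain ⟨j, -, rfl⟩ := Finset.mem_image.1 he
      fin_cases j
      exacts [h.1, h.2.1, h.2.2]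
    · rintro ⟨t₀, t₁, t₂⟩ - ht
      refine tripleProj_eq_zero (h2 k) (h3 k) (h5 k) fun h => ht ?_
      let c : (completeBipartiteGraph (Fin 3) (Fin 3)).edgeSet → ℤˣ := fun e =>
        if e = k33Edge k 0 then t₀ else if e = k33Edge k 1 then t₁ else t₂
      have c0 : c (k33Edge k 0) = t₀ := if_pos rfl
      have c1 : c (k33Edge k 1) = t₁ := by
        simp [c, (k33Edge_injective k).eq_iff]
      have c2 : c (k33Edge k 2) = t₂ := by
        simp [c, (k33Edge_injective k).eq_iff]
      have hc : ∏ e ∈ eqnSupport incidenceK33 k, c e = (-1) ^ (b k).val := by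
        rw [prod_eqnSupport_incidenceK33, Fin.prod_univ_three, c0, c1, c2]
        exact h
      refine ⟨mkSystemVertex k c hc, Finset.mem_filter.2 ⟨Finset.mem_univ _, rfl⟩, ?_⟩
      simp only [systemSign_mkSystemVertex hc (k33Edge_mem k _), c0, c1, c2]
    · intro ω hω
      obtain rfl : ω.1 = k := (Finset.mem_filter.1 hω).2
      refine congrArg (tripleProj _) (funext fun j => ?_)
      fin_cases j <;> rfl
  have hq : ∀ ω ω', q ω * q ω' ≠ 0 → ∀ e ∈ eqnSupport incidenceK33 ω.1,
      e ∈ eqnSupport incidenceK33 ω'.1 → systemSign ω e = systemSign ω' e := by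
    intro ω ω' h e he he'
    rw [eqnSupport_incidenceK33] at he he'
    obtain ⟨i, -, hi⟩ := Finset.mem_image.1 he
    obtain ⟨j, -, hj⟩ := Finset.mem_image.1 he'
    have hX := eq_of_k33Edge_eq h1 (hi.trans hj.symm)
    -- Evaluate the shared observable between the two projections from the left and from the right;
    -- the eigenvalues must agree unless the product vanishes.
    have e1 : q ω * X ω.1 i * q ω' = ((systemSign ω e : ℤ) : ℂ) • (q ω * q ω') := by
      rw [← (commute_tripleProj (h2 ω.1) _ i).eq, mul_tripleProj (h2 ω.1) (h3 ω.1), smul_mul_assoc,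
        hi]
    have e2 : q ω * X ω.1 i * q ω' = ((systemSign ω' e : ℤ) : ℂ) • (q ω * q ω') := by
      rw [hX, mul_assoc, mul_tripleProj (h2 ω'.1) (h3 ω'.1), mul_smul_comm, hj]
    rw [e1, ← sub_eq_zero, ← sub_smul, smul_eq_zero, or_iff_left h, sub_eq_zero] at e2
    exact Units.ext (by exact_mod_cast e2)
  refine (isQuantumIso_translationUnitary s (q := q) (fun k => by convert hsum k) hq).quantumIsomorphic
    fun x x' => ?_
  refine isSelfAdjoint_sum _ fun ω _ => ?_
  split_ifs
  · exact isSelfAdjoint_tripleProj (h2 _) (h4 _) _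
  · exact IsSelfAdjoint.zero _

theorem prod_eqnSign_eq_neg_one {b : Fin 3 ⊕ Fin 3 → ZMod 2} (hb : ∃! k, b k = 1) :
    ∏ k, eqnSign b k = -1 := by
  obtain ⟨k, hk, huniq⟩ := hb
  have h01 : ∀ x : ZMod 2, x ≠ 1 → x = 0 := by decide
  rw [Fintype.prod_eq_single k fun l hl => by
    rw [eqnSign, h01 (b l) fun h => hl (huniq l h)]
    rfl, eqnSign, hk]
  rfl

theorem corollary6p9 (b : Fin 3 ⊕ Fin 3 → ZMod 2) (hb : ∃! k, b k = 1)
    (n : Fin 3 ⊕ Fin 3 → ℕ) (hn : Function.Injective n)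
    (m : StarColor (completeBipartiteGraph (Fin 3) (Fin 3)).edgeSet → ℕ)
    (hm : Set.InjOn m {c | c ≠ Sum.inl (-1)}) :
    let G₀ := (starGraph incidenceK33 0).decolor (Sum.inl (-1)) n m
    let G₁ := (starGraph incidenceK33 b).decolor (Sum.inl (-1)) n m
    IsEmpty (G₀ ≃g G₁) ∧ NoQuantumSymmetry G₀ ∧ NoQuantumSymmetry G₁ ∧
      QuantumIsomorphic G₀ G₁ := by
  have hs := prod_eqnSign_eq_neg_one hb
  refine ⟨isEmpty_iso_starGraph hn hm ?_, noQuantumSymmetry_starGraph hn hm 0,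
    noQuantumSymmetry_starGraph hn hm b, quantumIsomorphic_starGraph hs n m⟩
  have h0 : ∀ k, eqnSign 0 k = 1 := fun k => rfl
  simp only [h0, one_mul]
  exact hs
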